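/- \textbf{Setting.} Let $N\ge 2$, let $\mathcal X$ be a tensor of dimensions $I_1\times\cdots\times I_N$, $I=\prod_k I_k$, fix a mode $n$, and let $A^{(k)}$ ($k\ne n$) be $I_k\times R$ matrices. MTTKRP computes the $I_n\times R$ matrix $B(i_n,r)=\sum \mathcal X(i)\prod_{k\ne n}A^{(k)}(i_k,r)$, the sum being over all $i$ with $n$-th entry $i_n$. A parallel MTTKRP algorithm on $P$ processors is a straight-line program in which each processor evaluates the products, each as one atomic multiply, and adds sums of products, using values in its own local memory (of unrestricted capacity, with accumulators that are initially empty), and in which values are sent from one processor to another one at a time. Initially each processor owns some of the input entries and finally some of the output entries; every output entry is finally owned by some processor. The algorithm is $(\gamma,\delta)$-balanced if each processor initially owns at most $\gamma I/P$ tensor entries, and the number of input matrix entries that it initially owns plus the number of output entries that it finally owns is at most $\delta\sum_k I_kR/P$. The cost of an algorithm is the largest number of sends plus receives of any processor. The parallel general algorithm uses a processor grid $P=P_0P_1\cdots P_N$ of positive integers. Each $[I_k]$ is partitioned into $P_k$ parts $S^{(k)}_{p}$ and $[R]$ into $P_0$ parts $T_{p}$ (parts may be empty). Processor $p=(p_0,\dots,p_N)$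 initially owns a part $\mathcal X_p$ of a partition of $\mathcal X(S^{(1)}_{p_1},\dots,S^{(N)}_{p_N})$ among the processors with the same $(p_1,\dots,p_N)$, and for $k\neq n$ a part $A^{(k)}_p$ of a partition of $A^{(k)}(S^{(k)}_{p_k},T_{p_0})$ among the processors with the same $(p_0,p_k)$; it finally owns a part $B_p$ of a partition of $B(S^{(n)}_{p_n},T_{p_0})$ among those with the same $(p_0,p_n)$. The algorithm All-Gathers the subtensors and the blocks of each $A^{(k)}$ over these sets of processors, performs a local MTTKRP on each processor, and Reduce-Scatters the contributions to $B$, with bucket collectives (a ring of $q$ processors, $q-1$ steps, each processor passing one block to its left neighbour in each step). The distribution is called even if $|\mathcal X_p|\le\lceil\prod_k\lceil I_k/P_k\rceil/P_0\rceil$, and $|A^{(k)}_p|$ for $k\ne n$ and $|B_p|$ for $k=n$ are at most $\lceil\lceil I_k/P_k\rceil\lceil R/P_0\rceil/(P/(P_kP_0))\rceil$, for all $p$. \textbf{Theorem.} Let $\alpha,\beta>1$, $\gamma>\alpha$, $\delta>\alpha^{1/N}\beta$, and suppose that for all $k$ $$P_k\le(\alpha^{1/N}-1)I_k,\quad P\le(\gamma-\alpha)I,\quad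 P_0\le(\beta-1)R,\quad P\le(\delta-\alpha^{1/N}\beta)I_kR .$$ (1) For all $\varepsilon,\eta>0$ there is a constant $C>0$, depending only on $\varepsilon,\eta$, such that the following holds. Suppose $NR\le(I/P)^{1-1/N}$, $P_0=1$, $I_k/P_k\le(\varepsilon/\delta)(I/P)^{1/N}$ for all $k$, $\eta<c$ with $c=(2/(3\gamma))^{1-1/N}$, and $$P\ge\Big(\frac{\delta}{c-\eta}\,\frac{\sum_k I_k}{N I^{1/N}}\Big)^{N/(N-1)} .$$ Then even distributions on the grid exist, and with every even distribution the parallel general algorithm is a $(\gamma,\delta)$-balanced parallel MTTKRP algorithm whose cost is at most $$C\cdot\min\Big\{c\,NR\,(I/P)^{1/N}-\delta\sum_k\frac{I_kR}{P},\ \frac{\gamma I}{2P}\Big\}$$ and at most $C$ times the cost of any $(\gamma,\delta)$-balanced parallel MTTKRP algorithm on $P$ processors for the same problem. (2) For all $\mu,\nu,\tau>0$ there is a constant $C>0$, depending only on $\mu,\nu,\tau$, such that the following holds. Suppose $NR>(I/P)^{1-1/N}$, $\tau<2-\gamma$, $$\frac{\delta}{\nu}\Big(\frac{(NR)^{N-1}}{(I/P)^N}\Big)^{\frac1{2N-1}}\frac{I_k}{P_k}\le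 P_0\le\frac{\mu}{\gamma}\Big(\frac{(NR)^N}{(I/P)^{N-1}}\Big)^{\frac1{2N-1}}\quad\text{for all }k,$$ $$P\ge\Big(\frac{\delta}{2-(\gamma+\tau)}\sum_k I_k\Big)^{\frac{2N-1}{N-1}}\frac{R}{(NI)^{N/(N-1)}} .$$ Then even distributions on the grid exist, and with every even distribution the parallel general algorithm is a $(\gamma,\delta)$-balanced parallel MTTKRP algorithm whose cost is at most $$C\cdot\Big(2\Big(\frac{NIR}{P}\Big)^{\frac N{2N-1}}-\gamma\frac IP-\delta\sum_k\frac{I_kR}{P}\Big)$$ and at most $C$ times the cost of any $(\gamma,\delta)$-balanced parallel MTTKRP algorithm on $P$ processors for the same problem. -/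

import Mathlib

noncomputable section

namespace MTTKRP

open Finset

/-! ## The problem -/

/-- The sizes of an MTTKRP problem: an `N`-way tensor `X` of dimensions `I 0 × ⋯ × I (N-1)`,
the number `R` of columns of the factor matrices, and the mode `n` of the output matrix. -/
structure Problem where
  N : ℕ
  I : Fin N → ℕ
  R : ℕ
  n : Fin N

section Machine

variable (S : Problem)

/-- Positions of the tensor. -/
abbrev Problem.TensorIdx : Type := ∀ k, Fin (S.I k)

/-- Positions of the input factor matrices `A k`, `k ≠ n`: a mode, a row and a column. -/
abbrev Problem.FactorIdx : Type := (k : {k : Fin S.N // k ≠ S.n}) × (Fin (S.I k.1) × Fin S.R)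

/-- Positions of the output matrix `B`. -/
abbrev Problem.OutIdx : Type := Fin (S.I S.n) × Fin S.R

/-- The iteration space; `(i, r)` stands for the product `X(i) * ∏ k ≠ n, A k (i k, r)`. -/
abbrev Problem.Iter : Type := S.TensorIdx × Fin S.R

/-- The number of tensor entries. -/
def Problem.size : ℕ := ∏ k, S.I k

/-- The number of factor matrix entries (inputs and output). -/
def Problem.factorSize : ℕ := ∑ k, S.I k * S.R

/-- The output entry to which a product contributes. -/
def Problem.target (x : S.Iter) : S.OutIdx := (x.1 S.n, x.2)

/-- The products whose sum is the output entry `o`, each once. -/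
def Problem.terms (o : S.OutIdx) : Finset S.Iter := univ.filter fun x => S.target x = o

/-! ## The parallel machine

Values are formal, since the arithmetic is that of an arbitrary set with two operations: a value is
an input entry or a sum of products. A product is only ever formed as one atomic multiply of an
entry of `X` with an entry of each input factor matrix. Sums are kept up to order and bracketing,
that is, as multisets of products; `psum 0` is an accumulator to which nothing has been added. -/

inductive Value : Type
  | tensor (i : S.TensorIdx)
  | factor (a : S.FactorIdx)
  | psum (m : Multiset S.Iter)

/-- Instructions. `mul p i r`: processor `p` evaluates the product with index `(i, r)`.
`add p a b`: processor `p` adds two sums of products.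
`comm p q v`: processor `p` sends the single value `v`, and processor `q` receives it. -/
inductive Instr (Proc : Type) : Type
  | mul (p : Proc) (i : S.TensorIdx) (r : Fin S.R)
  | add (p : Proc) (a b : Multiset S.Iter)
  | comm (src dst : Proc) (v : Value S)

/-- The contents of the local memories. Their capacity is not restricted. -/
abbrev State (Proc : Type) : Type := Proc → Set (Value S)

variable {S} {Proc : Type}

/-- The operands of an instruction are in the local memory of the processor that uses them. -/
def Instr.Enabled (σ : State S Proc) : Instr S Proc → Prop
  | .mul p i r => .tensor i ∈ σ p ∧ ∀ k : {k : Fin S.N // k ≠ S.n}, .factor ⟨k, i k.1, r⟩ ∈ σ p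
  | .add p a b => .psum a ∈ σ p ∧ .psum b ∈ σ p
  | .comm src _ v => v ∈ σ src

/-- The processor that obtains the result of an instruction. -/
def Instr.dst : Instr S Proc → Proc
  | .mul p _ _ => p
  | .add p _ _ => p
  | .comm _ q _ => q

/-- The result of an instruction. -/
def Instr.result : Instr S Proc → Value S
  | .mul _ i r => .psum {(i, r)}
  | .add _ a b => .psum (a + b)
  | .comm _ _ v => v

/-- The effect of an instruction on the local memories. -/
def Instr.step (σ : State S Proc) (c : Instr S Proc) : State S Proc :=
  fun q => {v | v ∈ σ q ∨ (q = c.dst ∧ v = c.result)}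

/-- A program (the instructions of all processors, in some sequential order that is compatible
with the parallel execution) finds all its operands in place. -/
def Legal : State S Proc → List (Instr S Proc) → Prop
  | _, [] => True
  | σ, c :: cs => c.Enabled σ ∧ Legal (c.step σ) cs

/-- The local memories after a program. -/
def run (σ : State S Proc) (cs : List (Instr S Proc)) : State S Proc := cs.foldl Instr.step σ

/-- The number of sends plus the number of receives of processor `p` in one instruction. -/
def Instr.words [DecidableEq Proc] (p : Proc) : Instr S Proc → ℕ
  | .comm src dst _ => (if src = p then 1 else 0) + (if dst = p then 1 else 0)
  | _ => 0

variable (S Proc) in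
/-- A parallel algorithm: the input entries that each processor owns before the execution, the
output entries that it owns after the execution, and the program. -/
structure ParAlg where
  initX : Proc → Finset S.TensorIdx
  initA : Proc → Finset S.FactorIdx
  finalB : Proc → Finset S.OutIdx
  prog : List (Instr S Proc)

/-- Initially a processor holds the input entries that it owns (and empty accumulators). -/
def ParAlg.initState (A : ParAlg S Proc) : State S Proc := fun p =>
  {v | (∃ i ∈ A.initX p, v = .tensor i) ∨ (∃ a ∈ A.initA p, v = .factor a) ∨ v = .psum 0}

/-- The algorithm is a parallel MTTKRP algorithm: it can be executed, every output entry is owned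
by some processor in the end, and each processor then holds the output entries that it owns. -/
def ParAlg.IsMTTKRP (A : ParAlg S Proc) : Prop :=
  Legal A.initState A.prog ∧
  (∀ o, ∃ p, o ∈ A.finalB p) ∧
  ∀ p, ∀ o ∈ A.finalB p, .psum (S.terms o).val ∈ run A.initState A.prog p

variable [Fintype Proc]

/-- Initially and finally, every processor owns at most `γ I / P` tensor entries and at most
`δ (∑ k, I k * R) / P` factor matrix entries. -/
def ParAlg.LoadBalanced (A : ParAlg S Proc) (γ δ : ℝ) : Prop :=
  ∀ p, ((A.initX p).card : ℝ) ≤ γ * S.size / Fintype.card Proc ∧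
    ((A.initA p).card + (A.finalB p).card : ℝ) ≤ δ * S.factorSize / Fintype.card Proc

variable [DecidableEq Proc]

/-- The communication cost: the largest number of sends and receives of a processor. -/
def ParAlg.cost (A : ParAlg S Proc) : ℕ :=
  univ.sup fun p => (A.prog.map (Instr.words p)).sum

/-! ## Collectives

The members of a communicator form a ring, given by a list; the left neighbour of position `j` is
position `j - 1`, cyclically. -/

/-- Bucket All-Gather, in `L.length - 1` steps. In step `s` position `j` passes to its left
neighbour the block `blk` of position `j + s`. -/
def allGather (L : List Proc) (blk : Proc → List (Value S)) : List (Instr S Proc) :=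
  (List.range (L.length - 1)).flatMap fun s =>
    (List.finRange L.length).flatMap fun j =>
      (blk (L.get ((finRotate L.length ^ s) j))).map fun v =>
        .comm (L.get j) (L.get ((finRotate L.length).symm j)) v

/-- Bucket Reduce-Scatter, in `L.length - 1` steps. Processor `p` contributes the sum
`contrib p o` to the output entry `o`; the total of the output entries in `blk p` is to arrive
at `p`. In step `s` position `j` passes to its left neighbour, for the block of position `j + s + 1`,
the sum of the contributions of positions `j, …, j + s`; the neighbour adds its own. -/
def reduceScatter (L : List Proc) (contrib : Proc → S.OutIdx → Multiset S.Iter)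
    (blk : Proc → List S.OutIdx) : List (Instr S Proc) :=
  (List.range (L.length - 1)).flatMap fun s =>
    (List.finRange L.length).flatMap fun j =>
      (blk (L.get ((finRotate L.length ^ (s + 1)) j))).flatMap fun o =>
        let left := L.get ((finRotate L.length).symm j)
        let acc := ∑ t ∈ range (s + 1), contrib (L.get ((finRotate L.length ^ t) j)) o
        [.comm (L.get j) left (.psum acc), .add left acc (contrib left o)]

/-- Run a collective in every communicator, where the communicators consist of the processors with
equal value of `key`. -/
def onEach {κ : Type} [Fintype κ] [DecidableEq κ] (key : Proc → κ)
    (f : List Proc → List (Instr S Proc)) : List (Instr S Proc) :=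
  (univ : Finset κ).toList.flatMap fun c => f (univ.filter fun p => key p = c).toList

/-- Processor `p` evaluates the products in a list and adds them, one by one, to the sum `acc`. -/
def accumulate (p : Proc) : Multiset S.Iter → List S.Iter → List (Instr S Proc)
  | _, [] => []
  | acc, x :: xs => .mul p x.1 x.2 :: .add p acc {x} :: accumulate p (acc + {x}) xs

end Machine

/-! ## The parallel general MTTKRP algorithm -/

/-- The shape `P₀ × P 0 × ⋯ × P (N-1)` of an `(N+1)`-way processor grid. -/
structure Grid (N : ℕ) where
  P₀ : ℕ
  P : Fin N → ℕ

/-- The processors of a grid. -/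
abbrev Grid.Proc {N : ℕ} (G : Grid N) : Type := Fin G.P₀ × (∀ k, Fin (G.P k))

/-- The number of processors of a grid. -/
def Grid.size {N : ℕ} (G : Grid N) : ℕ := G.P₀ * ∏ k, G.P k

/-- A data distribution on a grid. Each dimension `k` of the tensor is cut into `P k` parts
(`part k` tells which one a row is in) and the columns are cut into `P₀` parts. The entries of the
subtensor with parts `(p₁, …, p_N)` are distributed arbitrarily over the processors
`(·, p₁, …, p_N)`. For each `k`, the entries of the `k`-th factor matrix with row part `p_k` and
column part `p₀` are distributed arbitrarily over the processors with these two coordinates; for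
`k ≠ n` this is the input matrix `A k`, and for `k = n` the output matrix `B`. -/
structure Distribution (S : Problem) (G : Grid S.N) where
  part : ∀ k, Fin (S.I k) → Fin (G.P k)
  colPart : Fin S.R → Fin G.P₀
  ownerX : S.TensorIdx → G.Proc
  ownerX_part : ∀ i k, (ownerX i).2 k = part k (i k)
  ownerM : ∀ k, Fin (S.I k) → Fin S.R → G.Proc
  ownerM_part : ∀ k a r, (ownerM k a r).2 k = part k a
  ownerM_colPart : ∀ k a r, (ownerM k a r).1 = colPart r

namespace Distribution

variable {S : Problem} {G : Grid S.N} (D : Distribution S G)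

/-- The tensor entries owned by `p`. -/
def locX (p : G.Proc) : Finset S.TensorIdx := univ.filter fun i => D.ownerX i = p

/-- The entries of the `k`-th factor matrix owned by `p`. -/
def locM (k : Fin S.N) (p : G.Proc) : Finset (Fin (S.I k) × Fin S.R) :=
  univ.filter fun a => D.ownerM k a.1 a.2 = p

/-- The entries are spread evenly, up to rounding. -/
def Even : Prop :=
  ∀ p, (D.locX p).card ≤ (∏ k, (S.I k ⌈/⌉ G.P k)) ⌈/⌉ G.P₀ ∧
    ∀ k, (D.locM k p).card ≤
      ((S.I k ⌈/⌉ G.P k) * (S.R ⌈/⌉ G.P₀)) ⌈/⌉ (G.size / (G.P k * G.P₀))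

/-- The products of the local MTTKRP of `p` that contribute to the output entry `o`. -/
def localTerms (p : G.Proc) (o : S.OutIdx) : Finset S.Iter :=
  (S.terms o).filter fun x => D.colPart x.2 = p.1 ∧ ∀ k, D.part k (x.1 k) = p.2 k

/-- The output entries to which the local MTTKRP of `p` contributes. -/
def localOut (p : G.Proc) : Finset S.OutIdx :=
  univ.filter fun o => D.colPart o.2 = p.1 ∧ D.part S.n o.1 = p.2 S.n

/-- All-Gather of the subtensors, over the processors with equal `(p₁, …, p_N)`. -/
def gatherX : List (Instr S G.Proc) :=
  onEach (fun p : G.Proc => p.2) fun L => allGather L fun p => (D.locX p).toList.map .tensor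

/-- All-Gather of the blocks of `A k`, over the processors with equal `(p₀, p_k)`. -/
def gatherA (k : {k : Fin S.N // k ≠ S.n}) : List (Instr S G.Proc) :=
  onEach (fun p : G.Proc => (p.1, p.2 k.1)) fun L =>
    allGather L fun p => (D.locM k.1 p).toList.map fun a => .factor ⟨k, a⟩

/-- The local MTTKRPs. -/
def localMTTKRP : List (Instr S G.Proc) :=
  (univ : Finset G.Proc).toList.flatMap fun p =>
    (D.localOut p).toList.flatMap fun o => accumulate p 0 (D.localTerms p o).toList

/-- Reduce-Scatter of the blocks of `B`, over the processors with equal `(p₀, p_n)`. -/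
def scatterB : List (Instr S G.Proc) :=
  onEach (fun p : G.Proc => (p.1, p.2 S.n)) fun L =>
    reduceScatter L (fun p o => (D.localTerms p o).val) fun p => (D.locM S.n p).toList

/-- The parallel general MTTKRP algorithm. -/
def parGen : ParAlg S G.Proc where
  initX := D.locX
  initA p := univ.sigma fun k => D.locM k.1 p
  finalB := D.locM S.n
  prog := D.gatherX ++ (univ.toList.flatMap D.gatherA) ++ D.localMTTKRP ++ D.scatterB

end Distribution

/-! ## Optimality -/

/-- The grid consists of at least one processor, and the dimensions of the tensor and the rank are
large enough relative to the grid for a data distribution that is even up to rounding to own at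
most `γ I / P` tensor entries and `δ (∑ k, I k * R) / P` factor matrix entries per processor. -/
def Fits (S : Problem) (G : Grid S.N) (α β γ δ : ℝ) : Prop :=
  0 < G.P₀ ∧ (G.P₀ : ℝ) ≤ (β - 1) * S.R ∧ (G.size : ℝ) ≤ (γ - α) * S.size ∧
  ∀ k, 0 < G.P k ∧ (G.P k : ℝ) ≤ (α ^ (1 / S.N : ℝ) - 1) * S.I k ∧
    (G.size : ℝ) ≤ (δ - α ^ (1 / S.N : ℝ) * β) * (S.I k * S.R)

/-- On the grid `G` the parallel general algorithm is communication optimal up to the factor `C`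
among the parallel MTTKRP algorithms with the same number of processors and the balance constants
`γ`, `δ`, and its cost matches the quantity `lb` up to the factor `C`: even distributions exist,
and with any of them the algorithm is a balanced MTTKRP algorithm whose cost is at most `C * lb`
and at most `C` times the cost of any balanced parallel MTTKRP algorithm. -/
def CommOptimal (S : Problem) (G : Grid S.N) (γ δ C lb : ℝ) : Prop :=
  (∃ D : Distribution S G, D.Even) ∧
  ∀ D : Distribution S G, D.Even →
    D.parGen.IsMTTKRP ∧ D.parGen.LoadBalanced γ δ ∧ (D.parGen.cost : ℝ) ≤ C * lb ∧
    ∀ A : ParAlg S (Fin G.size), A.IsMTTKRP → A.LoadBalanced γ δ →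
      (D.parGen.cost : ℝ) ≤ C * A.cost

/-- The memory-independent lower bound that is strong when `N R ≥ (I / P) ^ (1 - 1 / N)`. -/
def lbGeneral (S : Problem) (P γ δ : ℝ) : ℝ :=
  2 * (S.N * S.size * S.R / P) ^ ((S.N : ℝ) / (2 * S.N - 1)) - γ * S.size / P
    - δ * S.factorSize / P

/-- The memory-independent lower bound that is strong when `N R ≤ (I / P) ^ (1 - 1 / N)`. -/
def lbStationary (S : Problem) (P γ δ : ℝ) : ℝ :=
  min ((2 / (3 * γ)) ^ (1 - 1 / S.N : ℝ) * (S.N * S.R) * (S.size / P) ^ (1 / S.N : ℝ)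
    - δ * S.factorSize / P) (γ * S.size / (2 * P))

end MTTKRP

end

/-!
A bucket collective rotates the blocks of a group of processors around a ring, and induction on the
number of steps shows which block each processor holds; so the parallel general algorithm computes
the MTTKRP, and its cost is the sum of the collectives' costs.

For the lower bounds, some processor evaluates at least `I R / P` of the products that reach the
output. If it touches `x` tensor entries and `M` matrix entries, a Hölder–Brascamp–Lieb (weighted
Loomis–Whitney) inequality bounds the number of these products by `x ^ (1 - 1 / N) * M / N`, while
load balance gives `x ≤ γ I / P + cost` and `M ≤ δ ∑ I_k R / P + cost`. With few columns this forces
`M` to be of order `N R (I / P) ^ (1 / N)` unless `x` is already too large to be owned; with many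
columns the inequality of the means bounds `x + M` from below by `2 (N I R / P) ^ (N / (2 N - 1))`.
In each regime the grid keeps the cost of the algorithm within a constant of the same quantity.
-/

noncomputable section

namespace MTTKRP

open Finset

section Execution

variable {S : Problem} {Proc : Type}

theorem run_cons (σ : State S Proc) (c : Instr S Proc) (l : List (Instr S Proc)) :
    run σ (c :: l) = run (c.step σ) l := rfl

theorem run_append (σ : State S Proc) (l l' : List (Instr S Proc)) :
    run σ (l ++ l') = run (run σ l) l' := List.foldl_append

theorem mem_run_iff {σ : State S Proc} {l : List (Instr S Proc)} {p : Proc} {v : Value S} :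
    v ∈ run σ l p ↔ v ∈ σ p ∨ ∃ c ∈ l, c.dst = p ∧ c.result = v := by
  induction l generalizing σ with
  | nil => simp [run]
  | cons c l ih =>
    rw [run_cons, ih]
    simp only [Instr.step, Set.mem_ofPred_eq, List.exists_mem_cons_iff, or_assoc, eq_comm]

theorem le_run (σ : State S Proc) (l : List (Instr S Proc)) : σ ≤ run σ l :=
  fun _ _ hv => mem_run_iff.2 (Or.inl hv)

theorem run_le_run_of_subset (σ : State S Proc) {l l' : List (Instr S Proc)} (h : l ⊆ l') :
    run σ l ≤ run σ l' :=
  fun _ _ hv => mem_run_iff.2 ((mem_run_iff.1 hv).imp_right fun ⟨c, hc, hcv⟩ => ⟨c, h hc, hcv⟩)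

theorem Instr.Enabled.mono {σ τ : State S Proc} (h : σ ≤ τ) {c : Instr S Proc}
    (hc : c.Enabled σ) : c.Enabled τ := by
  cases c with
  | mul p i r => exact ⟨h _ hc.1, fun k => h _ (hc.2 k)⟩
  | add p a b => exact ⟨h _ hc.1, h _ hc.2⟩
  | comm p q v => exact h _ hc

theorem Legal.mono {σ τ : State S Proc} (h : σ ≤ τ) {l : List (Instr S Proc)}
    (hl : Legal σ l) : Legal τ l := by
  induction l generalizing σ τ with
  | nil => trivial
  | cons c l ih => exact ⟨hl.1.mono h, ih (fun q _ hv => hv.imp_left (h q ·)) hl.2⟩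

theorem legal_append {σ : State S Proc} {l l' : List (Instr S Proc)} :
    Legal σ (l ++ l') ↔ Legal σ l ∧ Legal (run σ l) l' := by
  induction l generalizing σ with
  | nil => simp only [List.nil_append, Legal, run, List.foldl_nil, true_and]
  | cons c l ih => simp only [List.cons_append, Legal, ih, and_assoc, run_cons]

theorem legal_flatMap {α : Type*} {σ : State S Proc} {f : α → List (Instr S Proc)} {xs : List α}
    (h : ∀ x ∈ xs, Legal σ (f x)) : Legal σ (xs.flatMap f) := by
  induction xs generalizing σ with
  | nil => trivial
  | cons x xs ih =>
    rw [List.flatMap_cons, legal_append]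
    exact ⟨h x List.mem_cons_self,
      ih fun y hy => (h y (List.mem_cons_of_mem x hy)).mono (le_run _ _)⟩

theorem legal_map {α : Type*} {σ : State S Proc} {f : α → Instr S Proc} {xs : List α}
    (h : ∀ x ∈ xs, (f x).Enabled σ) : Legal σ (xs.map f) := by
  rw [List.map_eq_flatMap]
  exact legal_flatMap fun x hx => ⟨h x hx, trivial⟩

theorem legal_flatMap_range {σ : State S Proc} {f : ℕ → List (Instr S Proc)} {m : ℕ}
    (h : ∀ s < m, Legal (run σ ((List.range s).flatMap f)) (f s)) :
    Legal σ ((List.range m).flatMap f) := by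
  induction m with
  | zero => trivial
  | succ m ih =>
    rw [List.range_succ, List.flatMap_append, legal_append, List.flatMap_singleton]
    exact ⟨ih fun s hs => h s (hs.trans m.lt_succ_self), h m m.lt_succ_self⟩

theorem run_le_run_flatMap {α : Type*} (σ : State S Proc) (f : α → List (Instr S Proc))
    {xs : List α} {x : α} (hx : x ∈ xs) : run σ (f x) ≤ run σ (xs.flatMap f) :=
  run_le_run_of_subset σ fun _ hc => List.mem_flatMap_of_mem hx hc

theorem legal_accumulate {p : Proc} {xs : List S.Iter} {acc : Multiset S.Iter}
    {σ : State S Proc} (hacc : .psum acc ∈ σ p)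
    (hxs : ∀ x ∈ xs, Instr.Enabled σ (.mul p x.1 x.2)) : Legal σ (accumulate p acc xs) := by
  induction xs generalizing acc σ with
  | nil => trivial
  | cons x xs ih =>
    let l : List (Instr S Proc) := [.mul p x.1 x.2, .add p acc {x}]
    have hacc' : .psum (acc + {x}) ∈ run σ l p := Or.inr ⟨rfl, rfl⟩
    exact ⟨hxs x List.mem_cons_self, ⟨Or.inl hacc, Or.inr ⟨rfl, rfl⟩⟩,
      ih hacc' fun y hy => (hxs y (List.mem_cons_of_mem x hy)).mono (le_run σ l)⟩

theorem psum_mem_run_accumulate {p : Proc} {xs : List S.Iter} {acc : Multiset S.Iter}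
    {σ : State S Proc} (hacc : .psum acc ∈ σ p) :
    .psum (acc + (xs : Multiset S.Iter)) ∈ run σ (accumulate p acc xs) p := by
  induction xs generalizing acc σ with
  | nil => simpa only [accumulate, run, List.foldl_nil, Multiset.coe_nil, add_zero] using hacc
  | cons x xs ih =>
    have hacc' : .psum (acc + {x}) ∈ run σ [.mul p x.1 x.2, .add p acc {x}] p :=
      Or.inr ⟨rfl, rfl⟩
    rw [← Multiset.cons_coe, ← Multiset.singleton_add, ← add_assoc]
    exact ih hacc'

end Execution

section Rotation

theorem finRotate_pow_succ_symm_apply {n : ℕ} (s : ℕ) (j : Fin n) :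
    (finRotate n ^ (s + 1)) ((finRotate n).symm j) = (finRotate n ^ s) j := by
  rw [pow_succ, Equiv.Perm.mul_apply, Equiv.apply_symm_apply]

theorem val_finRotate_pow {n : ℕ} (s : ℕ) (j : Fin n) :
    ((finRotate n ^ s) j : ℕ) = (j + s) % n := by
  cases n with
  | zero => exact j.elim0
  | succ n =>
    induction s with
    | zero => simp only [pow_zero, Equiv.Perm.coe_one, id_eq, add_zero, Nat.mod_eq_of_lt j.2]
    | succ s ih =>
      rw [pow_succ', Equiv.Perm.mul_apply, finRotate_apply, Fin.val_add, ih, Fin.val_one',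
        ← Nat.add_mod, add_assoc]

theorem finRotate_pow_self {n : ℕ} (j : Fin n) : (finRotate n ^ n) j = j :=
  Fin.ext <| by rw [val_finRotate_pow, Nat.add_mod_right, Nat.mod_eq_of_lt j.2]

theorem exists_finRotate_pow_eq {n : ℕ} (i j : Fin n) :
    ∃ t ≤ n - 1, (finRotate n ^ t) j = i := by
  refine ⟨(i + (n - j)) % n, Nat.le_sub_one_of_lt (Nat.mod_lt _ i.pos), Fin.ext ?_⟩
  rw [val_finRotate_pow, Nat.add_mod_mod, show (j : ℕ) + (i + (n - j)) = i + n by omega,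
    Nat.add_mod_right, Nat.mod_eq_of_lt i.2]

theorem sum_range_finRotate_pow {n : ℕ} {M : Type*} [AddCommMonoid M] (f : Fin n → M)
    (j : Fin n) : ∑ t ∈ range n, f ((finRotate n ^ t) j) = ∑ i, f i := by
  rw [← Fin.sum_univ_eq_sum_range (fun t => f ((finRotate n ^ t) j))]
  refine Function.Bijective.sum_comp (e := fun t : Fin n => (finRotate n ^ (t : ℕ)) j) ?_ f
  refine Finite.surjective_iff_bijective.1 fun i => ?_
  obtain ⟨t, ht, h⟩ := exists_finRotate_pow_eq i j
  exact ⟨⟨t, by have := i.pos; omega⟩, h⟩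

end Rotation

section Collectives

variable {S : Problem} {Proc : Type}

/-- Step `s` of `allGather`: every processor of the ring passes to its left neighbour the block that
started `s` places to its right. -/
def allGatherStep (L : List Proc) (blk : Proc → List (Value S)) (s : ℕ) : List (Instr S Proc) :=
  (List.finRange L.length).flatMap fun j =>
    (blk (L.get ((finRotate L.length ^ s) j))).map fun v =>
      .comm (L.get j) (L.get ((finRotate L.length).symm j)) v

theorem mem_run_allGatherStep {L : List Proc} {blk : Proc → List (Value S)} {σ : State S Proc}
    (h : ∀ p ∈ L, ∀ v ∈ blk p, v ∈ σ p) {m t : ℕ} (ht : t ≤ m) {j : Fin L.length} {v : Value S}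
    (hv : v ∈ blk (L.get ((finRotate L.length ^ t) j))) :
    v ∈ run σ ((List.range m).flatMap (allGatherStep L blk)) (L.get j) := by
  cases t with
  | zero => exact le_run _ _ _ (h _ (List.get_mem _ _) v hv)
  | succ s =>
    obtain ⟨i, rfl⟩ := (finRotate L.length).symm.surjective j
    rw [finRotate_pow_succ_symm_apply] at hv
    refine mem_run_iff.2 (Or.inr ⟨.comm (L.get i) _ v, ?_, rfl, rfl⟩)
    refine List.mem_flatMap_of_mem (List.mem_range.2 ht) ?_
    exact List.mem_flatMap_of_mem (List.mem_finRange i) (List.mem_map_of_mem hv)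

theorem legal_allGather {L : List Proc} {blk : Proc → List (Value S)} {σ : State S Proc}
    (h : ∀ p ∈ L, ∀ v ∈ blk p, v ∈ σ p) : Legal σ (allGather L blk) :=
  legal_flatMap_range fun _ _ => legal_flatMap fun _ _ => legal_map fun _ hv =>
    mem_run_allGatherStep h le_rfl hv

theorem mem_run_allGather {L : List Proc} {blk : Proc → List (Value S)} {σ : State S Proc}
    (h : ∀ p ∈ L, ∀ v ∈ blk p, v ∈ σ p) {p q : Proc} (hp : p ∈ L) (hq : q ∈ L) {v : Value S}
    (hv : v ∈ blk q) : v ∈ run σ (allGather L blk) p := by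
  obtain ⟨j, rfl⟩ := List.get_of_mem hp
  obtain ⟨i, rfl⟩ := List.get_of_mem hq
  obtain ⟨t, ht, rfl⟩ := exists_finRotate_pow_eq i j
  exact mem_run_allGatherStep h ht hv

/-- Step `s` of `reduceScatter`: every processor of the ring passes to its left neighbour the block
`s + 1` places to its right, with the contributions collected so far, and the neighbour adds its
own. -/
def reduceScatterStep (L : List Proc) (contrib : Proc → S.OutIdx → Multiset S.Iter)
    (blk : Proc → List S.OutIdx) (s : ℕ) : List (Instr S Proc) :=
  (List.finRange L.length).flatMap fun j =>
    (blk (L.get ((finRotate L.length ^ (s + 1)) j))).flatMap fun o =>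
      let left := L.get ((finRotate L.length).symm j)
      let acc := ∑ t ∈ range (s + 1), contrib (L.get ((finRotate L.length ^ t) j)) o
      [.comm (L.get j) left (.psum acc), .add left acc (contrib left o)]

theorem reduceScatter_eq_flatMap (L : List Proc) (contrib : Proc → S.OutIdx → Multiset S.Iter)
    (blk : Proc → List S.OutIdx) : reduceScatter L contrib blk =
      (List.range (L.length - 1)).flatMap (reduceScatterStep L contrib blk) := rfl

variable {L : List Proc} {contrib : Proc → S.OutIdx → Multiset S.Iter}
  {blk : Proc → List S.OutIdx} {σ : State S Proc}

theorem mem_run_reduceScatterStep (h : ∀ p ∈ L, ∀ q ∈ L, ∀ o ∈ blk q, .psum (contrib p o) ∈ σ p)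
    {m : ℕ} {j : Fin L.length} {o : S.OutIdx}
    (ho : o ∈ blk (L.get ((finRotate L.length ^ (m + 1)) j))) :
    .psum (∑ t ∈ range (m + 1), contrib (L.get ((finRotate L.length ^ t) j)) o) ∈
      run σ ((List.range m).flatMap (reduceScatterStep L contrib blk)) (L.get j) := by
  cases m with
  | zero =>
    rw [zero_add, sum_range_one]
    exact le_run _ _ _ (h _ (List.get_mem _ _) _ (List.get_mem _ _) o ho)
  | succ s =>
    obtain ⟨i, rfl⟩ := (finRotate L.length).symm.surjective j
    rw [finRotate_pow_succ_symm_apply] at ho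
    simp only [sum_range_succ' _ (s + 1), finRotate_pow_succ_symm_apply, pow_zero,
      Equiv.Perm.coe_one, id_eq]
    refine mem_run_iff.2 (Or.inr ⟨.add _ _ _, ?_, rfl, rfl⟩)
    refine List.mem_flatMap_of_mem (List.mem_range.2 s.lt_succ_self) ?_
    refine List.mem_flatMap_of_mem (List.mem_finRange i) (List.mem_flatMap_of_mem ho ?_)
    exact List.mem_cons_of_mem _ List.mem_cons_self

theorem legal_reduceScatter (h : ∀ p ∈ L, ∀ q ∈ L, ∀ o ∈ blk q, .psum (contrib p o) ∈ σ p) :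
    Legal σ (reduceScatter L contrib blk) := by
  refine legal_flatMap_range fun s _ => legal_flatMap fun j _ => legal_flatMap fun o ho => ?_
  have hadd := h (L.get ((finRotate L.length).symm j)) (List.get_mem _ _) _ (List.get_mem _ _) o ho
  exact ⟨mem_run_reduceScatterStep h ho, ⟨Or.inr ⟨rfl, rfl⟩, Or.inl (le_run _ _ _ hadd)⟩, trivial⟩

theorem sum_mem_run_reduceScatter
    (h : ∀ p ∈ L, ∀ q ∈ L, ∀ o ∈ blk q, .psum (contrib p o) ∈ σ p) {p : Proc} (hp : p ∈ L)
    {o : S.OutIdx} (ho : o ∈ blk p) :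
    .psum (L.map fun q => contrib q o).sum ∈ run σ (reduceScatter L contrib blk) p := by
  obtain ⟨j, rfl⟩ := List.get_of_mem hp
  have hlen : L.length - 1 + 1 = L.length := Nat.succ_pred_eq_of_pos j.pos
  have hmem := mem_run_reduceScatterStep (m := L.length - 1) (j := j) (o := o) h
    (by rwa [hlen, finRotate_pow_self])
  rw [hlen, sum_range_finRotate_pow (fun i => contrib (L.get i) o)] at hmem
  simpa only [reduceScatter_eq_flatMap, List.get_eq_getElem,
    Fin.sum_univ_fun_getElem L (contrib · o)] using hmem

variable [Fintype Proc] {κ : Type} [Fintype κ] [DecidableEq κ] {key : Proc → κ}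

theorem legal_onEach {f : List Proc → List (Instr S Proc)}
    (h : ∀ c, Legal σ (f (univ.filter fun p => key p = c).toList)) : Legal σ (onEach key f) :=
  legal_flatMap fun c _ => h c

theorem run_le_run_onEach (key : Proc → κ) (f : List Proc → List (Instr S Proc))
    (σ : State S Proc) (c : κ) :
    run σ (f (univ.filter fun p => key p = c).toList) ≤ run σ (onEach key f) :=
  run_le_run_flatMap σ (fun c => f (univ.filter fun p => key p = c).toList)
    (mem_toList.2 (mem_univ c))

theorem legal_onEach_allGather {blk : Proc → List (Value S)} (h : ∀ p, ∀ v ∈ blk p, v ∈ σ p) :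
    Legal σ (onEach key fun L => allGather L blk) :=
  legal_onEach fun _ => legal_allGather fun p _ => h p

theorem mem_run_onEach_allGather {blk : Proc → List (Value S)} (h : ∀ p, ∀ v ∈ blk p, v ∈ σ p)
    {p q : Proc} (hpq : key q = key p) {v : Value S} (hv : v ∈ blk q) :
    v ∈ run σ (onEach key fun L => allGather L blk) p := by
  refine run_le_run_onEach key (allGather · blk) σ (key p) p
    (mem_run_allGather (fun p _ => h p) (q := q) ?_ ?_ hv)
  · exact mem_toList.2 (mem_filter_univ p |>.2 rfl)
  · exact mem_toList.2 (mem_filter_univ q |>.2 hpq)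

theorem legal_onEach_reduceScatter
    (h : ∀ p q, key p = key q → ∀ o ∈ blk q, .psum (contrib p o) ∈ σ p) :
    Legal σ (onEach key fun L => reduceScatter L contrib blk) := by
  refine legal_onEach fun c => legal_reduceScatter fun p hp q hq => h p q ?_
  rw [mem_toList, mem_filter_univ] at hp hq
  exact hp.trans hq.symm

theorem sum_mem_run_onEach_reduceScatter
    (h : ∀ p q, key p = key q → ∀ o ∈ blk q, .psum (contrib p o) ∈ σ p) {p : Proc} {o : S.OutIdx}
    (ho : o ∈ blk p) : .psum (∑ q with key q = key p, contrib q o) ∈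
      run σ (onEach key fun L => reduceScatter L contrib blk) p := by
  set L := (univ.filter fun q => key q = key p).toList
  have hmem : ∀ q ∈ L, key q = key p := fun q hq => mem_filter_univ q |>.1 (mem_toList.1 hq)
  have hsum : ∑ q with key q = key p, contrib q o = (L.map fun q => contrib q o).sum :=
    (sum_map_toList _ _).symm
  rw [hsum]
  refine run_le_run_onEach key (reduceScatter · contrib blk) σ (key p) p ?_
  exact sum_mem_run_reduceScatter
    (fun p' hp' q hq => h p' q ((hmem p' hp').trans (hmem q hq).symm))
    (mem_toList.2 (mem_filter_univ p |>.2 rfl)) ho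

end Collectives

namespace Distribution

variable {S : Problem} {G : Grid S.N} (D : Distribution S G) {σ : State S G.Proc}

theorem mem_locX_iff {p : G.Proc} {i : S.TensorIdx} : i ∈ D.locX p ↔ D.ownerX i = p :=
  mem_filter_univ i

theorem mem_locM_iff {k : Fin S.N} {p : G.Proc} {a : Fin (S.I k) × Fin S.R} :
    a ∈ D.locM k p ↔ D.ownerM k a.1 a.2 = p :=
  mem_filter_univ a

theorem key_ownerM (k : Fin S.N) (a : Fin (S.I k)) (r : Fin S.R) :
    ((D.ownerM k a r).1, (D.ownerM k a r).2 k) = (D.colPart r, D.part k a) := by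
  rw [D.ownerM_colPart, D.ownerM_part]

theorem legal_gatherX (h : ∀ p, ∀ i ∈ D.locX p, .tensor i ∈ σ p) : Legal σ D.gatherX := by
  refine legal_onEach_allGather fun p v hv => ?_
  obtain ⟨i, hi, rfl⟩ := List.mem_map.1 hv
  exact h p i (mem_toList.1 hi)

theorem tensor_mem_run_gatherX (h : ∀ p, ∀ i ∈ D.locX p, .tensor i ∈ σ p) {p : G.Proc}
    {i : S.TensorIdx} (hi : ∀ k, D.part k (i k) = p.2 k) : .tensor i ∈ run σ D.gatherX p := by
  refine mem_run_onEach_allGather (fun p v hv => ?_) (q := D.ownerX i)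
    (funext fun k => (D.ownerX_part i k).trans (hi k))
    (List.mem_map_of_mem (mem_toList.2 (D.mem_locX_iff.2 rfl)))
  obtain ⟨i, hi, rfl⟩ := List.mem_map.1 hv
  exact h p i (mem_toList.1 hi)

theorem legal_gatherA {k : {k : Fin S.N // k ≠ S.n}}
    (h : ∀ p, ∀ a ∈ D.locM k.1 p, .factor ⟨k, a⟩ ∈ σ p) : Legal σ (D.gatherA k) := by
  refine legal_onEach_allGather fun p v hv => ?_
  obtain ⟨a, ha, rfl⟩ := List.mem_map.1 hv
  exact h p a (mem_toList.1 ha)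

theorem factor_mem_run_gatherA {k : {k : Fin S.N // k ≠ S.n}}
    (h : ∀ p, ∀ a ∈ D.locM k.1 p, .factor ⟨k, a⟩ ∈ σ p) {p : G.Proc}
    {a : Fin (S.I k.1) × Fin S.R} (ha : (D.colPart a.2, D.part k.1 a.1) = (p.1, p.2 k.1)) :
    .factor ⟨k, a⟩ ∈ run σ (D.gatherA k) p := by
  refine mem_run_onEach_allGather (fun p v hv => ?_) (q := D.ownerM k.1 a.1 a.2)
    ((D.key_ownerM k.1 a.1 a.2).trans ha)
    (List.mem_map_of_mem (mem_toList.2 (D.mem_locM_iff.2 rfl)))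
  obtain ⟨a, ha, rfl⟩ := List.mem_map.1 hv
  exact h p a (mem_toList.1 ha)

theorem legal_localMTTKRP (h0 : ∀ p, .psum 0 ∈ σ p)
    (hmul : ∀ p o, ∀ x ∈ D.localTerms p o, Instr.Enabled σ (.mul p x.1 x.2)) :
    Legal σ D.localMTTKRP :=
  legal_flatMap fun p _ => legal_flatMap fun o _ =>
    legal_accumulate (h0 p) fun x hx => hmul p o x (mem_toList.1 hx)

theorem psum_mem_run_localMTTKRP (h0 : ∀ p, .psum 0 ∈ σ p) {p : G.Proc} {o : S.OutIdx}
    (ho : o ∈ D.localOut p) : .psum (D.localTerms p o).val ∈ run σ D.localMTTKRP p := by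
  have hmem := psum_mem_run_accumulate (xs := (D.localTerms p o).toList) (h0 p)
  rw [coe_toList, zero_add] at hmem
  refine run_le_run_of_subset σ (fun c hc => ?_) p hmem
  exact List.mem_flatMap_of_mem (mem_toList.2 (mem_univ p))
    (List.mem_flatMap_of_mem (mem_toList.2 ho) hc)

theorem count_localTerms (p : G.Proc) (o : S.OutIdx) (x : S.Iter) [Decidable (x ∈ S.terms o)] :
    (D.localTerms p o).val.count x = if p = (D.colPart x.2, fun k => D.part k (x.1 k)) then
      (if x ∈ S.terms o then 1 else 0) else 0 := by
  rw [Multiset.count_eq_of_nodup (nodup _), ← ite_and]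
  refine if_congr ?_ rfl rfl
  rw [mem_val, localTerms, mem_filter, Prod.ext_iff, funext_iff, and_comm]
  simp only [eq_comm]

theorem sum_localTerms (o : S.OutIdx) :
    ∑ p : G.Proc with (p.1, p.2 S.n) = (D.colPart o.2, D.part S.n o.1), (D.localTerms p o).val
      = (S.terms o).val := by
  classical
  ext x
  simp only [Multiset.count_sum', D.count_localTerms, sum_ite_eq', mem_filter_univ,
    Multiset.count_eq_of_nodup (nodup _), mem_val]
  by_cases hx : x ∈ S.terms o
  · obtain rfl := mem_filter_univ x |>.1 hx
    exact if_pos rfl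
  · simp only [if_neg hx, ite_self]

theorem mem_localOut_of_mem_locM {p q : G.Proc} (hpq : (p.1, p.2 S.n) = (q.1, q.2 S.n))
    {o : S.OutIdx} (ho : o ∈ D.locM S.n q) : o ∈ D.localOut p := by
  obtain rfl := D.mem_locM_iff.1 ho
  exact mem_filter_univ o |>.2 (Prod.ext_iff.1 (hpq.trans (D.key_ownerM S.n o.1 o.2)).symm)

theorem legal_scatterB (h : ∀ p, ∀ o ∈ D.localOut p, .psum (D.localTerms p o).val ∈ σ p) :
    Legal σ D.scatterB :=
  legal_onEach_reduceScatter fun p _ hpq o ho =>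
    h p o (D.mem_localOut_of_mem_locM hpq (mem_toList.1 ho))

theorem psum_terms_mem_run_scatterB
    (h : ∀ p, ∀ o ∈ D.localOut p, .psum (D.localTerms p o).val ∈ σ p) {p : G.Proc} {o : S.OutIdx}
    (ho : o ∈ D.locM S.n p) : .psum (S.terms o).val ∈ run σ D.scatterB p := by
  have hmem := sum_mem_run_onEach_reduceScatter (σ := σ) (key := fun p : G.Proc => (p.1, p.2 S.n))
    (contrib := fun p o => (D.localTerms p o).val) (blk := fun p => (D.locM S.n p).toList)
    (fun p _ hpq o ho => h p o (D.mem_localOut_of_mem_locM hpq (mem_toList.1 ho)))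
    (mem_toList.2 ho)
  obtain rfl := D.mem_locM_iff.1 ho
  rwa [D.key_ownerM, D.sum_localTerms] at hmem

theorem parGen_isMTTKRP : D.parGen.IsMTTKRP := by
  have hX : ∀ p, ∀ i ∈ D.locX p, .tensor i ∈ D.parGen.initState p :=
    fun p i hi => Or.inl ⟨i, hi, rfl⟩
  set σ₁ := run D.parGen.initState D.gatherX
  have hσ₁ : D.parGen.initState ≤ σ₁ := le_run _ _
  have hA : ∀ k : {k : Fin S.N // k ≠ S.n}, ∀ p, ∀ a ∈ D.locM k.1 p, .factor ⟨k, a⟩ ∈ σ₁ p :=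
    fun k p a ha => hσ₁ _ (Or.inr (Or.inl ⟨⟨k, a⟩, mem_sigma.2 ⟨mem_univ k, ha⟩, rfl⟩))
  set σ₂ := run σ₁ (univ.toList.flatMap D.gatherA)
  have hσ₂ : σ₁ ≤ σ₂ := le_run _ _
  have h0 : ∀ p, .psum 0 ∈ σ₂ p := fun p => hσ₂ _ (hσ₁ _ (Or.inr (Or.inr rfl)))
  have hmul : ∀ p o, ∀ x ∈ D.localTerms p o, Instr.Enabled σ₂ (.mul p x.1 x.2) := by
    intro p o x hx
    obtain ⟨-, hcol, hpart⟩ := mem_filter.1 hx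
    refine ⟨hσ₂ _ (D.tensor_mem_run_gatherX hX hpart), fun k => ?_⟩
    exact run_le_run_flatMap σ₁ _ (mem_toList.2 (mem_univ k)) _
      (D.factor_mem_run_gatherA (hA k) (Prod.ext hcol (hpart k)))
  have hL : ∀ p, ∀ o ∈ D.localOut p, .psum (D.localTerms p o).val ∈ run σ₂ D.localMTTKRP p :=
    fun p o ho => D.psum_mem_run_localMTTKRP h0 ho
  refine ⟨?_, fun o => ⟨D.ownerM S.n o.1 o.2, D.mem_locM_iff.2 rfl⟩, fun p o ho => ?_⟩
  · simp only [parGen, legal_append, run_append]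
    exact ⟨⟨⟨D.legal_gatherX hX, legal_flatMap fun k _ => D.legal_gatherA (hA k)⟩,
      D.legal_localMTTKRP h0 hmul⟩, D.legal_scatterB hL⟩
  · simp only [parGen, run_append]
    exact D.psum_terms_mem_run_scatterB hL ho

end Distribution

section Words

variable {S : Problem} {Proc : Type} [DecidableEq Proc]

/-- The number of sends plus the number of receives of `p` in a program. -/
def totalWords (p : Proc) (l : List (Instr S Proc)) : ℕ := (l.map (Instr.words p)).sum

theorem totalWords_cons (p : Proc) (c : Instr S Proc) (l : List (Instr S Proc)) :
    totalWords p (c :: l) = c.words p + totalWords p l := by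
  rw [totalWords, List.map_cons, List.sum_cons, totalWords]

theorem totalWords_append (p : Proc) (l l' : List (Instr S Proc)) :
    totalWords p (l ++ l') = totalWords p l + totalWords p l' := by
  rw [totalWords, List.map_append, List.sum_append, totalWords, totalWords]

theorem totalWords_flatMap {α : Type*} (p : Proc) (f : α → List (Instr S Proc)) (xs : List α) :
    totalWords p (xs.flatMap f) = (xs.map fun x => totalWords p (f x)).sum := by
  induction xs with
  | nil => rfl
  | cons x xs ih => rw [List.flatMap_cons, totalWords_append, ih, List.map_cons, List.sum_cons]

theorem totalWords_toList_flatMap {α : Type*} (p : Proc) (f : α → List (Instr S Proc))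
    (s : Finset α) : totalWords p (s.toList.flatMap f) = ∑ x ∈ s, totalWords p (f x) := by
  rw [totalWords_flatMap, sum_map_toList]

theorem totalWords_flatMap_le {α : Type*} {p : Proc} {f : α → List (Instr S Proc)} {xs : List α}
    {b : ℕ} (h : ∀ x ∈ xs, totalWords p (f x) ≤ b) :
    totalWords p (xs.flatMap f) ≤ xs.length * b := by
  rw [totalWords_flatMap, ← List.length_map (fun x => totalWords p (f x)), ← smul_eq_mul]
  exact List.sum_le_card_nsmul _ b (List.forall_mem_map.2 h)

theorem totalWords_accumulate (p q : Proc) (acc : Multiset S.Iter) (xs : List S.Iter) :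
    totalWords p (accumulate q acc xs) = 0 := by
  induction xs generalizing acc with
  | nil => rfl
  | cons x xs ih => rw [accumulate, totalWords_cons, totalWords_cons, ih]; rfl

theorem sum_get_eq_count (L : List Proc) (p : Proc) :
    ∑ j, (if L.get j = p then 1 else 0) = L.count p := by
  simp only [List.get_eq_getElem, Fin.sum_univ_fun_getElem L fun q => if q = p then 1 else 0]
  induction L with
  | nil => rfl
  | cons q L ih =>
    simp only [List.map_cons, List.sum_cons, ih, List.count_cons, beq_iff_eq, add_comm]

theorem totalWords_ring_le {L : List Proc} {p : Proc} {b : ℕ}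
    {f : Fin L.length → List (Instr S Proc)}
    (hf : ∀ j, totalWords p (f j) ≤ b * ((if L.get j = p then 1 else 0) +
      (if L.get ((finRotate L.length).symm j) = p then 1 else 0))) :
    totalWords p ((List.finRange L.length).flatMap f) ≤ 2 * b * L.count p := by
  rw [totalWords_flatMap, ← Fin.sum_univ_def]
  refine (sum_le_sum fun j _ => hf j).trans_eq ?_
  rw [← mul_sum, sum_add_distrib,
    Equiv.sum_comp (finRotate L.length).symm (fun j => if L.get j = p then 1 else 0),
    sum_get_eq_count]
  ring

theorem totalWords_allGather_le {blk : Proc → List (Value S)} {p : Proc} {b : ℕ}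
    (hb : ∀ q, (blk q).length ≤ b) (L : List Proc) :
    totalWords p (allGather L blk) ≤ (L.length - 1) * (2 * b * L.count p) := by
  refine (totalWords_flatMap_le fun s _ => totalWords_ring_le fun j => ?_).trans_eq
    (by rw [List.length_range])
  rw [List.map_eq_flatMap]
  refine (totalWords_flatMap_le fun v _ => ?_).trans (Nat.mul_le_mul_right _ (hb _))
  rfl

theorem totalWords_reduceScatter_le {contrib : Proc → S.OutIdx → Multiset S.Iter}
    {blk : Proc → List S.OutIdx} {p : Proc} {b : ℕ} (hb : ∀ q, (blk q).length ≤ b)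
    (L : List Proc) :
    totalWords p (reduceScatter L contrib blk) ≤ (L.length - 1) * (2 * b * L.count p) := by
  refine (totalWords_flatMap_le fun s _ => totalWords_ring_le fun j => ?_).trans_eq
    (by rw [List.length_range])
  refine (totalWords_flatMap_le fun o _ => ?_).trans (Nat.mul_le_mul_right _ (hb _))
  rfl

variable [Fintype Proc] {κ : Type} [Fintype κ] [DecidableEq κ]

theorem totalWords_onEach_le {key : Proc → κ} {f : List Proc → List (Instr S Proc)} {p : Proc}
    {b : ℕ} (hf : ∀ L, totalWords p (f L) ≤ (L.length - 1) * (2 * b * L.count p)) :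
    totalWords p (onEach key f) ≤ (#{q | key q = key p} - 1) * (2 * b) := by
  rw [onEach, totalWords_toList_flatMap]
  refine (sum_le_sum fun c _ => hf _).trans_eq ?_
  have hmem : ∀ c, p ∈ ({q | key q = c} : Finset Proc).toList ↔ key p = c := fun c => by
    rw [mem_toList, mem_filter_univ]
  rw [sum_eq_single_of_mem (key p) (mem_univ _) fun c _ hc => ?_]
  · rw [List.count_eq_one_of_mem (nodup_toList _) ((hmem _).2 rfl), length_toList, mul_one]
  · rw [List.count_eq_zero_of_not_mem fun h => hc ((hmem c).1 h).symm, mul_zero, mul_zero]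

end Words

section GridCounts

variable {N : ℕ} (G : Grid N)

theorem Grid.card_proc : Fintype.card G.Proc = G.size := by
  simp only [Grid.Proc, Fintype.card_prod, Fintype.card_pi, Fintype.card_fin, Grid.size]

theorem Grid.card_filter_snd_eq (c : ∀ k, Fin (G.P k)) :
    #{p : G.Proc | p.2 = c} = G.P₀ := by
  have h : ({p : G.Proc | p.2 = c} : Finset G.Proc) = univ ×ˢ {c} := by
    ext p
    simp only [mem_filter_univ, mem_product, mem_univ, true_and, mem_singleton]
  rw [h, card_product, card_singleton, mul_one, card_univ, Fintype.card_fin]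

theorem Grid.card_filter_key (k : Fin N) (c : Fin G.P₀ × Fin (G.P k)) :
    #{p : G.Proc | (p.1, p.2 k) = c} = G.size / (G.P k * G.P₀) := by
  have h : ({p : G.Proc | (p.1, p.2 k) = c} : Finset G.Proc) =
      {c.1} ×ˢ {f ∈ Fintype.piFinset fun l => (univ : Finset (Fin (G.P l))) | f k = c.2} := by
    ext p
    simp only [mem_product, mem_singleton, mem_filter, Prod.ext_iff,
      Fintype.mem_piFinset, mem_univ, implies_true, true_and]
  rw [h, card_product, card_singleton, one_mul,
    Fintype.card_filter_piFinset_eq_of_mem (fun l => (univ : Finset (Fin (G.P l)))) k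
      (mem_univ c.2)]
  simp only [card_univ, Fintype.card_fin]
  rw [Grid.size, ← mul_prod_erase univ G.P (mem_univ k), ← mul_assoc, mul_comm G.P₀,
    Nat.mul_div_cancel_left _ (Nat.mul_pos c.2.pos c.1.pos)]

end GridCounts

namespace Distribution

variable {S : Problem} {G : Grid S.N} (D : Distribution S G)

theorem totalWords_gatherX_le {b : ℕ} (hb : ∀ p, #(D.locX p) ≤ b) (p : G.Proc) :
    totalWords p D.gatherX ≤ (G.P₀ - 1) * (2 * b) := by
  refine (totalWords_onEach_le (totalWords_allGather_le fun q => ?_)).trans_eq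
    (by rw [G.card_filter_snd_eq])
  rw [List.length_map, length_toList]
  exact hb q

theorem totalWords_gatherA_le (k : {k : Fin S.N // k ≠ S.n}) {b : ℕ}
    (hb : ∀ p, #(D.locM k.1 p) ≤ b) (p : G.Proc) :
    totalWords p (D.gatherA k) ≤ (G.size / (G.P k.1 * G.P₀) - 1) * (2 * b) := by
  refine (totalWords_onEach_le (totalWords_allGather_le fun q => ?_)).trans_eq
    (by rw [G.card_filter_key])
  rw [List.length_map, length_toList]
  exact hb q

theorem totalWords_localMTTKRP (p : G.Proc) : totalWords p D.localMTTKRP = 0 := by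
  simp only [localMTTKRP, totalWords_toList_flatMap, totalWords_accumulate, sum_const_zero]

theorem totalWords_scatterB_le {b : ℕ} (hb : ∀ p, #(D.locM S.n p) ≤ b) (p : G.Proc) :
    totalWords p D.scatterB ≤ (G.size / (G.P S.n * G.P₀) - 1) * (2 * b) := by
  refine (totalWords_onEach_le (totalWords_reduceScatter_le fun q => ?_)).trans_eq
    (by rw [G.card_filter_key])
  rw [length_toList]
  exact hb q

theorem cost_parGen_le {bX : ℕ} {bM : Fin S.N → ℕ} (hX : ∀ p, #(D.locX p) ≤ bX)
    (hM : ∀ k p, #(D.locM k p) ≤ bM k) : D.parGen.cost ≤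
      (G.P₀ - 1) * (2 * bX) + ∑ k, (G.size / (G.P k * G.P₀) - 1) * (2 * bM k) := by
  refine Finset.sup_le fun p _ => ?_
  have hA := sum_le_sum fun k (_ : k ∈ univ) => D.totalWords_gatherA_le k (hM k.1) p
  have hprog : totalWords p D.parGen.prog = totalWords p D.gatherX
      + ∑ k, totalWords p (D.gatherA k) + totalWords p D.scatterB := by
    simp only [parGen, totalWords_append, totalWords_toList_flatMap, D.totalWords_localMTTKRP,
      add_zero]
  change totalWords p D.parGen.prog ≤ _
  rw [hprog, Fintype.sum_eq_add_sum_subtype_ne _ S.n]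
  linarith [D.totalWords_gatherX_le hX p, D.totalWords_scatterB_le (hM S.n) p]

end Distribution

section EvenAssignment

variable {α β κ : Type*} [Fintype α] [Fintype β] [DecidableEq β] {m : ℕ}

theorem exists_card_fiber_le (h : Fintype.card α ≤ Fintype.card β * m) :
    ∃ f : α → β, ∀ b, #{a | f a = b} ≤ m := by
  obtain ⟨e⟩ : Nonempty (α ↪ β × Fin m) := Function.Embedding.nonempty_of_card_le
    (by rwa [Fintype.card_prod, Fintype.card_fin])
  refine ⟨fun a => (e a).1, fun b => ?_⟩
  refine (card_le_card_of_injOn (t := (univ : Finset (Fin m))) (fun a => (e a).2)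
    (fun _ _ => mem_univ _) fun a ha a' ha' haa' => ?_).trans_eq (card_fin m)
  rw [mem_coe, mem_filter_univ] at ha ha'
  exact e.injective (Prod.ext (ha.trans ha'.symm) haa')

theorem exists_card_fiber_le_of_key [DecidableEq κ] {keyA : α → κ} {keyB : β → κ}
    (h : ∀ c, #{a | keyA a = c} ≤ #{b | keyB b = c} * m) :
    ∃ f : α → β, (∀ a, keyB (f a) = keyA a) ∧ ∀ b, #{a | f a = b} ≤ m := by
  choose f hf using fun c => exists_card_fiber_le (α := {a // keyA a = c})
    (β := {b // keyB b = c}) (m := m) (by simpa only [Fintype.card_subtype] using h c)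
  have hkey : ∀ {a c} (hac : keyA a = c), (f (keyA a) ⟨a, rfl⟩ : β) = f c ⟨a, hac⟩ := by
    rintro a _ rfl
    rfl
  refine ⟨fun a => f (keyA a) ⟨a, rfl⟩, fun a => (f _ _).2, fun b => ?_⟩
  refine le_trans ?_ (hf (keyB b) ⟨b, rfl⟩)
  rw [← card_map (Function.Embedding.subtype _)]
  refine card_le_card fun a ha => ?_
  rw [mem_filter_univ] at ha
  have hac : keyA a = keyB b := by rw [← ha, (f (keyA a) ⟨a, rfl⟩).2]
  refine mem_map.2 ⟨⟨a, hac⟩, mem_filter_univ _ |>.2 (Subtype.ext ?_), rfl⟩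
  exact (hkey hac).symm.trans ha

theorem exists_card_fiber_le_ceilDiv (n : ℕ) {q : ℕ} (hq : 0 < q) :
    ∃ f : Fin n → Fin q, ∀ c, #{i | f i = c} ≤ n ⌈/⌉ q :=
  exists_card_fiber_le <| by
    rw [Fintype.card_fin, Fintype.card_fin]
    exact le_smul_ceilDiv hq

theorem exists_even_distribution {S : Problem} {G : Grid S.N} (h₀ : 0 < G.P₀)
    (h : ∀ k, 0 < G.P k) : ∃ D : Distribution S G, D.Even := by
  choose part part_le using fun k => exists_card_fiber_le_ceilDiv (S.I k) (h k)
  obtain ⟨col, col_le⟩ := exists_card_fiber_le_ceilDiv S.R h₀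
  have hpos : ∀ k, 0 < G.size / (G.P k * G.P₀) := by
    intro k
    rw [← G.card_filter_key k (⟨0, h₀⟩, ⟨0, h k⟩)]
    exact card_pos.2 ⟨(⟨0, h₀⟩, fun l => ⟨0, h l⟩), mem_filter_univ _ |>.2 rfl⟩
  obtain ⟨ownerX, ownerX_key, ownerX_le⟩ := exists_card_fiber_le_of_key
    (keyA := fun (i : S.TensorIdx) k => part k (i k)) (keyB := fun p : G.Proc => p.2)
    (m := (∏ k, (S.I k ⌈/⌉ G.P k)) ⌈/⌉ G.P₀) fun c => by
      rw [G.card_filter_snd_eq]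
      refine le_trans ?_ (le_smul_ceilDiv h₀)
      refine le_trans (le_of_eq ?_) (prod_le_prod' fun k _ => part_le k (c k))
      simp only [← Fintype.card_piFinset, funext_iff]
      congr 1
      ext i
      simp only [mem_filter_univ, Fintype.mem_piFinset]
  choose ownerM ownerM_key ownerM_le using fun k => exists_card_fiber_le_of_key
    (keyA := fun a : Fin (S.I k) × Fin S.R => (col a.2, part k a.1))
    (keyB := fun p : G.Proc => (p.1, p.2 k))
    (m := ((S.I k ⌈/⌉ G.P k) * (S.R ⌈/⌉ G.P₀)) ⌈/⌉ (G.size / (G.P k * G.P₀))) fun c => by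
      rw [G.card_filter_key]
      refine le_trans ?_ (le_smul_ceilDiv (hpos k))
      refine le_trans (le_of_eq ?_) (Nat.mul_le_mul (part_le k c.2) (col_le c.1))
      rw [← card_product]
      congr 1
      ext a
      simp only [mem_filter_univ, mem_product, Prod.ext_iff, and_comm]
  exact ⟨⟨part, col, ownerX, fun i k => congrFun (ownerX_key i) k, fun k a r => ownerM k (a, r),
    fun k a r => congrArg Prod.snd (ownerM_key k (a, r)),
    fun k a r => congrArg Prod.fst (ownerM_key k (a, r))⟩,
    fun p => ⟨ownerX_le p, fun k => ownerM_le k p⟩⟩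

end EvenAssignment

section Geometry

variable {ι : Type*} [Fintype ι] {κ : ι → Type*} [∀ k, DecidableEq (κ k)]

theorem card_le_prod_card_image (T : Finset (∀ k, κ k)) :
    #T ≤ ∏ k, #(T.image fun i => i k) := by
  classical
  rw [← Fintype.card_piFinset]
  exact card_le_card fun i hi => Fintype.mem_piFinset.2 fun k => mem_image_of_mem _ hi

theorem card_le_rpow_mul_sum_card_image [Nonempty ι] (T : Finset (∀ k, κ k)) {x : ℝ}
    (hx : #T ≤ x) : (#T : ℝ) ≤ x ^ (1 - 1 / Fintype.card ι : ℝ) *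
      ((∑ k, (#(T.image fun i => i k) : ℝ)) / Fintype.card ι) := by
  have hx₀ : 0 ≤ x := (Nat.cast_nonneg _).trans hx
  set n : ℝ := (Fintype.card ι : ℝ)
  have hn : 1 ≤ n := Nat.one_le_cast.2 Fintype.card_pos
  have hn' : 1 / n ≤ 1 := (div_le_one (by linarith)).2 hn
  have hprod : (#T : ℝ) ≤ ∏ k, (#(T.image fun i => i k) : ℝ) := by
    exact_mod_cast card_le_prod_card_image T
  have amgm : (∏ k, (#(T.image fun i => i k) : ℝ)) ^ (1 / n) ≤
      (∑ k, (#(T.image fun i => i k) : ℝ)) / n := by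
    rw [← Real.finsetProd_rpow _ _ fun k _ => Nat.cast_nonneg _, sum_div]
    refine (Real.geom_mean_le_arith_mean_weighted univ (fun _ => 1 / n) _ (fun _ _ => by positivity)
      ?_ fun _ _ => Nat.cast_nonneg _).trans_eq (sum_congr rfl fun k _ => one_div_mul_eq_div _ _)
    rw [sum_const, card_univ, nsmul_eq_mul, mul_one_div_cancel (by positivity)]
  calc (#T : ℝ) = (#T : ℝ) ^ (1 - 1 / n) * (#T : ℝ) ^ (1 / n) := by
        rw [← Real.rpow_add_of_nonneg (by positivity) (by linarith) (by positivity),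
          sub_add_cancel, Real.rpow_one]
    _ ≤ x ^ (1 - 1 / n) * ((∑ k, (#(T.image fun i => i k) : ℝ)) / n) := by
        gcongr
        exact (Real.rpow_le_rpow (by positivity) hprod (by positivity)).trans amgm

variable {ρ : Type*} [DecidableEq ρ]

/-- The section of a set of pairs over a given second coordinate. -/
def slice {α : Type*} [DecidableEq α] (F : Finset (α × ρ)) (r : ρ) : Finset α :=
  {z ∈ F | z.2 = r}.image Prod.fst

theorem mem_slice_iff {α : Type*} [DecidableEq α] {F : Finset (α × ρ)} {r : ρ} {a : α} :
    a ∈ slice F r ↔ (a, r) ∈ F := by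
  simp only [slice, mem_image, mem_filter]
  exact ⟨by rintro ⟨⟨_, _⟩, ⟨h, rfl⟩, rfl⟩; exact h, fun h => ⟨_, ⟨h, rfl⟩, rfl⟩⟩

theorem card_eq_sum_card_slice {α : Type*} [DecidableEq α] [Fintype ρ] (F : Finset (α × ρ)) :
    #F = ∑ r, #(slice F r) := by
  rw [card_eq_sum_card_fiberwise (f := Prod.snd) (t := univ) fun _ _ => mem_univ _]
  refine sum_congr rfl fun r _ => (card_image_of_injOn fun z hz w hw h => ?_).symm
  exact Prod.ext h ((mem_filter.1 hz).2.trans (mem_filter.1 hw).2.symm)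

theorem slice_image {α β : Type*} [DecidableEq α] [DecidableEq β] (f : α → β)
    (F : Finset (α × ρ)) (r : ρ) :
    slice (F.image fun z => (f z.1, z.2)) r = (slice F r).image f := by
  ext b
  simp only [mem_slice_iff, mem_image, Prod.mk.injEq, Prod.exists, exists_eq_right_right]

theorem card_le_rpow_mul_sum_card_image_prod [Nonempty ι] [Finite ρ]
    (F : Finset ((∀ k, κ k) × ρ)) :
    (#F : ℝ) ≤ (#(F.image Prod.fst) : ℝ) ^ (1 - 1 / Fintype.card ι : ℝ) *
      ((∑ k, (#(F.image fun z => (z.1 k, z.2)) : ℝ)) / Fintype.card ι) := by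
  have := Fintype.ofFinite ρ
  have hslice : ∀ r, (#(slice F r) : ℝ) ≤ #(F.image Prod.fst) := fun r => by
    exact_mod_cast card_le_card (image_subset_image (filter_subset _ _))
  have himage : ∀ k, #(F.image fun z => (z.1 k, z.2)) =
      ∑ r, #((slice F r).image fun i => i k) := fun k => by
    simp only [card_eq_sum_card_slice (F.image _), slice_image (fun i : ∀ k, κ k => i k)]
  rw [card_eq_sum_card_slice, Nat.cast_sum]
  refine (sum_le_sum fun r _ => card_le_rpow_mul_sum_card_image _ (hslice r)).trans_eq ?_
  rw [← mul_sum, ← sum_div, sum_comm]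
  simp only [himage, Nat.cast_sum]

end Geometry

section Provenance

variable {S : Problem} {Proc : Type}

theorem Legal.enabled {σ : State S Proc} {l : List (Instr S Proc)} (hl : Legal σ l)
    {c : Instr S Proc} (hc : c ∈ l) : c.Enabled (run σ l) := by
  obtain ⟨l₁, l₂, rfl⟩ := List.append_of_mem hc
  exact (legal_append.1 hl).2.1.mono fun _ _ hv =>
    run_le_run_of_subset σ (List.subset_append_left _ _) _ hv

theorem tensor_mem_run {σ : State S Proc} {l : List (Instr S Proc)} {p : Proc}
    {i : S.TensorIdx} (h : .tensor i ∈ run σ l p) :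
    .tensor i ∈ σ p ∨ ∃ q, .comm q p (.tensor i) ∈ l := by
  refine (mem_run_iff.1 h).imp_right ?_
  rintro ⟨_ | _ | ⟨q, p, v⟩, hc, rfl, hv⟩ <;> cases hv
  exact ⟨q, hc⟩

theorem factor_mem_run {σ : State S Proc} {l : List (Instr S Proc)} {p : Proc}
    {a : S.FactorIdx} (h : .factor a ∈ run σ l p) :
    .factor a ∈ σ p ∨ ∃ q, .comm q p (.factor a) ∈ l := by
  refine (mem_run_iff.1 h).imp_right ?_
  rintro ⟨_ | _ | ⟨q, p, v⟩, hc, rfl, hv⟩ <;> cases hv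
  exact ⟨q, hc⟩

/-- `p` sends a sum of products that contains `x` and contributes to the output entry `o` only. -/
def Forwards (l : List (Instr S Proc)) (p : Proc) (o : S.OutIdx) (x : S.Iter) : Prop :=
  ∃ q m, Instr.comm p q (.psum m) ∈ l ∧ x ∈ m ∧ ∀ y ∈ m, S.target y = o

theorem Forwards.mono {l l' : List (Instr S Proc)} (h : l ⊆ l') {p : Proc} {o : S.OutIdx}
    {x : S.Iter} : Forwards l p o x → Forwards l' p o x :=
  fun ⟨q, m, hc, hm⟩ => ⟨q, m, h hc, hm⟩

-- Follow `x` backwards from the final sum: an `add` hands it down from an operand of the same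
-- processor, and a `comm` comes from a processor that forwards it.
theorem exists_mul_of_mem_psum {σ : State S Proc} (hσ : ∀ p m, .psum m ∈ σ p → m = 0)
    {l : List (Instr S Proc)} (hl : Legal σ l) {q : Proc} {m : Multiset S.Iter} {o : S.OutIdx}
    (hm : .psum m ∈ run σ l q) (ho : ∀ y ∈ m, S.target y = o) {x : S.Iter} (hx : x ∈ m) :
    ∃ p, .mul p x.1 x.2 ∈ l ∧ (p = q ∨ Forwards l p o x) := by
  induction l using List.reverseRecOn generalizing q m with
  | nil => exact absurd hx (hσ q m hm ▸ Multiset.notMem_zero x)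
  | append_singleton l c ih =>
    have hsub : l ⊆ l ++ [c] := List.subset_append_left _ _
    obtain ⟨hl, hc, -⟩ := legal_append.1 hl
    have lift : ∀ {q m}, .psum m ∈ run σ l q → (∀ y ∈ m, S.target y = o) → x ∈ m →
        ∃ p, .mul p x.1 x.2 ∈ l ++ [c] ∧ (p = q ∨ Forwards (l ++ [c]) p o x) := by
      intro q m hm ho hx
      obtain ⟨p, hmul, h⟩ := ih hl hm ho hx
      exact ⟨p, hsub hmul, h.imp_right (Forwards.mono hsub)⟩
    rw [run_append] at hm
    rcases hm with hm | ⟨rfl, hv⟩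
    · exact lift hm ho hx
    · cases c with
      | mul p i r =>
        cases hv
        cases Multiset.mem_singleton.1 hx
        exact ⟨p, List.mem_concat_self, Or.inl rfl⟩
      | add p a b =>
        cases hv
        rcases Multiset.mem_add.1 hx with hx | hx
        · exact lift hc.1 (fun y hy => ho y (Multiset.mem_add.2 (Or.inl hy))) hx
        · exact lift hc.2 (fun y hy => ho y (Multiset.mem_add.2 (Or.inr hy))) hx
      | comm s q v =>
        cases hv
        obtain ⟨p, hmul, rfl | h⟩ := lift hc ho hx
        · exact ⟨p, hmul, Or.inr ⟨q, m, List.mem_concat_self, hx, ho⟩⟩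
        · exact ⟨p, hmul, Or.inr h⟩

namespace ParAlg

variable (A : ParAlg S Proc)

open Classical in
/-- The products that `p` evaluates and passes on towards an output entry. The others may be
recomputed or discarded, so that no communication can be charged to them. -/
def useful (p : Proc) : Finset S.Iter :=
  univ.filter fun x => .mul p x.1 x.2 ∈ A.prog ∧
    (S.target x ∈ A.finalB p ∨ Forwards A.prog p (S.target x) x)

variable {A}

theorem mem_useful_iff {p : Proc} {x : S.Iter} : x ∈ A.useful p ↔ .mul p x.1 x.2 ∈ A.prog ∧
    (S.target x ∈ A.finalB p ∨ Forwards A.prog p (S.target x) x) := by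
  simp only [useful, mem_filter_univ]

theorem IsMTTKRP.exists_useful (hA : A.IsMTTKRP) (x : S.Iter) : ∃ p, x ∈ A.useful p := by
  obtain ⟨hlegal, howned, hfinal⟩ := hA
  obtain ⟨q, hq⟩ := howned (S.target x)
  have hinit : ∀ p m, .psum m ∈ A.initState p → m = 0 := by
    rintro p m (⟨_, _, h⟩ | ⟨_, _, h⟩ | h) <;> cases h
    rfl
  obtain ⟨p, hmul, rfl | h⟩ := exists_mul_of_mem_psum hinit hlegal (hfinal q _ hq)
    (fun y hy => (mem_filter.1 hy).2) (mem_filter_univ x |>.2 rfl)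
  · exact ⟨p, mem_useful_iff.2 ⟨hmul, Or.inl hq⟩⟩
  · exact ⟨p, mem_useful_iff.2 ⟨hmul, Or.inr h⟩⟩

theorem IsMTTKRP.exists_card_le_useful [Fintype Proc] [Nonempty Proc] (hA : A.IsMTTKRP) :
    ∃ p, S.size * S.R ≤ Fintype.card Proc * #(A.useful p) := by
  classical
  have hcard : S.size * S.R ≤ ∑ p, #(A.useful p) := by
    calc S.size * S.R = #(univ : Finset S.Iter) := by
          simp only [Problem.size, card_univ, Fintype.card_prod, Fintype.card_pi, Fintype.card_fin]
      _ ≤ #(univ.biUnion A.useful) := card_le_card fun x _ =>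
          let ⟨p, hp⟩ := hA.exists_useful x
          mem_biUnion.2 ⟨p, mem_univ _, hp⟩
      _ ≤ ∑ p, #(A.useful p) := card_biUnion_le
  obtain ⟨p, -, hp⟩ := exists_le_of_sum_le (s := univ) (f := fun _ : Proc => S.size * S.R)
    (g := fun p => Fintype.card Proc * #(A.useful p)) univ_nonempty <| by
      rw [sum_const, smul_eq_mul, ← mul_sum]
      exact Nat.mul_le_mul_left _ hcard
  exact ⟨p, hp⟩

end ParAlg

end Provenance

section Traffic

variable {S : Problem} {Proc : Type} [DecidableEq Proc]

/-- The values received by `p`. -/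
def received (p : Proc) (l : List (Instr S Proc)) : List (Value S) :=
  l.filterMap fun
    | .comm _ q v => if q = p then some v else none
    | _ => none

/-- The values sent by `p`. -/
def sent (p : Proc) (l : List (Instr S Proc)) : List (Value S) :=
  l.filterMap fun
    | .comm q _ v => if q = p then some v else none
    | _ => none

theorem length_sent_add_length_received (p : Proc) (l : List (Instr S Proc)) :
    (sent p l).length + (received p l).length = totalWords p l := by
  induction l with
  | nil => rfl
  | cons c l ih =>
    rw [totalWords_cons, ← ih]
    cases c with
    | comm q r v =>
      by_cases hq : q = p <;> by_cases hr : r = p <;>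
        simp [sent, received, Instr.words, hq, hr] <;> omega
    | _ => simp [sent, received, Instr.words]

theorem mem_received {p q : Proc} {l : List (Instr S Proc)} {v : Value S}
    (h : .comm q p v ∈ l) : v ∈ received p l :=
  List.mem_filterMap.2 ⟨_, h, if_pos rfl⟩

theorem mem_sent {p q : Proc} {l : List (Instr S Proc)} {v : Value S}
    (h : .comm p q v ∈ l) : v ∈ sent p l :=
  List.mem_filterMap.2 ⟨_, h, if_pos rfl⟩

theorem card_le_card_add_length {α β : Type*} {r : α → β → Prop} (hr : Relator.LeftUnique r)
    {s t : Finset α} {l : List β} (h : ∀ a ∈ s, a ∈ t ∨ ∃ b ∈ l, r a b) :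
    #s ≤ #t + l.length := by
  classical
  have hsdiff : #(s \ t) ≤ #l.toFinset := by
    refine card_le_card_of_forall_subsingleton r (fun a ha => ?_)
      fun b _ a ha a' ha' => hr ha.2 ha'.2
    obtain ⟨has, hat⟩ := mem_sdiff.1 ha
    simpa only [List.mem_toFinset] using (h a has).resolve_left hat
  have := card_le_card_sdiff_add_card (s := s) (t := t)
  have := l.toFinset_card_le
  omega

namespace ParAlg

variable {A : ParAlg S Proc}

theorem IsMTTKRP.card_useful_tensor_le (hA : A.IsMTTKRP) (p : Proc) :
    #((A.useful p).image Prod.fst) ≤ #(A.initX p) + (received p A.prog).length := by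
  refine card_le_card_add_length (r := fun i v => v = .tensor i)
    (by rintro i j _ rfl h; cases h; rfl) fun i hi => ?_
  obtain ⟨x, hx, rfl⟩ := mem_image.1 hi
  have hheld := (hA.1.enabled (mem_useful_iff.1 hx).1).1
  rcases tensor_mem_run hheld with (⟨j, hj, h⟩ | ⟨a, _, h⟩ | h) | ⟨q, hq⟩
  · cases h
    exact Or.inl hj
  · cases h
  · cases h
  · exact Or.inr ⟨_, mem_received hq, rfl⟩

theorem IsMTTKRP.card_useful_factor_le (hA : A.IsMTTKRP) (p : Proc) :
    ∑ k : {k : Fin S.N // k ≠ S.n}, #((A.useful p).image fun z => (z.1 k.1, z.2)) ≤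
      #(A.initA p) + (received p A.prog).length := by
  rw [← card_sigma]
  refine card_le_card_add_length (r := fun a v => v = .factor a)
    (by rintro a b _ rfl h; cases h; rfl) ?_
  rintro ⟨k, a⟩ ha
  obtain ⟨x, hx, rfl : (x.1 k.1, x.2) = a⟩ := mem_image.1 (mem_sigma.1 ha).2
  have hheld := (hA.1.enabled (mem_useful_iff.1 hx).1).2 k
  rcases factor_mem_run hheld with (⟨i, _, h⟩ | ⟨a, ha, h⟩ | h) | ⟨q, hq⟩
  · cases h
  · cases h
    exact Or.inl ha
  · cases h
  · exact Or.inr ⟨_, mem_received hq, rfl⟩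

theorem card_useful_target_le (p : Proc) :
    #((A.useful p).image S.target) ≤ #(A.finalB p) + (sent p A.prog).length := by
  refine card_le_card_add_length
    (r := fun o v => ∃ m, v = .psum m ∧ (∃ x, x ∈ m) ∧ ∀ y ∈ m, S.target y = o) ?_ fun o ho => ?_
  · rintro o o' _ ⟨m, rfl, ⟨x, hx⟩, ho⟩ ⟨_, h, -, ho'⟩
    cases h
    exact (ho x hx).symm.trans (ho' x hx)
  · obtain ⟨x, hx, rfl⟩ := mem_image.1 ho
    refine (mem_useful_iff.1 hx).2.imp_right ?_
    rintro ⟨q, m, hq, hxm, hm⟩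
    exact ⟨_, mem_sent hq, m, rfl, ⟨x, hxm⟩, hm⟩

variable [Fintype Proc]

theorem length_sent_add_length_received_le_cost (p : Proc) :
    (sent p A.prog).length + (received p A.prog).length ≤ A.cost :=
  (length_sent_add_length_received p A.prog).trans_le
    (le_sup (f := fun p => (A.prog.map (Instr.words p)).sum) (mem_univ p))

theorem IsMTTKRP.sum_card_useful_le (hA : A.IsMTTKRP) (p : Proc) :
    ∑ k, #((A.useful p).image fun z => (z.1 k, z.2)) ≤
      #(A.initA p) + #(A.finalB p) + A.cost := by
  have hfactor := hA.card_useful_factor_le p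
  have htarget : #((A.useful p).image fun z => (z.1 S.n, z.2)) ≤ _ := card_useful_target_le p
  have hcost := length_sent_add_length_received_le_cost (A := A) p
  rw [Fintype.sum_eq_add_sum_subtype_ne _ S.n]
  omega

-- `x` and `M` count the tensor and matrix entries that a processor with its full share of the
-- products accesses.
theorem IsMTTKRP.exists_access [Nonempty Proc] (hA : A.IsMTTKRP) {γ δ : ℝ}
    (hbal : A.LoadBalanced γ δ) : ∃ x M : ℝ, 0 ≤ x ∧ 0 ≤ M ∧
      x ≤ γ * S.size / Fintype.card Proc + A.cost ∧
      M ≤ δ * S.factorSize / Fintype.card Proc + A.cost ∧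
      S.N * S.size * S.R / Fintype.card Proc ≤ x ^ (1 - 1 / S.N : ℝ) * M := by
  obtain ⟨p, hp⟩ := hA.exists_card_le_useful
  obtain ⟨hX, hM⟩ := hbal p
  have hP : (0 : ℝ) < Fintype.card Proc := Nat.cast_pos.2 Fintype.card_pos
  have hN : (0 : ℝ) < S.N := Nat.cast_pos.2 S.n.pos
  have : Nonempty (Fin S.N) := ⟨S.n⟩
  have hreceived : (received p A.prog).length ≤ A.cost :=
    le_of_add_le_right (length_sent_add_length_received_le_cost p)
  have hx : (#((A.useful p).image Prod.fst) : ℝ) ≤ #(A.initX p) + A.cost := by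
    exact_mod_cast (hA.card_useful_tensor_le p).trans (Nat.add_le_add_left hreceived _)
  have hM' : ∑ k, (#((A.useful p).image fun z => (z.1 k, z.2)) : ℝ) ≤
      #(A.initA p) + #(A.finalB p) + A.cost := by
    exact_mod_cast hA.sum_card_useful_le p
  refine ⟨#((A.useful p).image Prod.fst), ∑ k, (#((A.useful p).image fun z => (z.1 k, z.2)) : ℝ),
    Nat.cast_nonneg _, sum_nonneg fun k _ => Nat.cast_nonneg _, by linarith, by linarith, ?_⟩
  have hshare : (S.size * S.R : ℝ) ≤ Fintype.card Proc * #(A.useful p) := by exact_mod_cast hp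
  have hgeom := card_le_rpow_mul_sum_card_image_prod (A.useful p)
  rw [Fintype.card_fin, mul_div_assoc', le_div_iff₀ hN] at hgeom
  rw [div_le_iff₀ hP]
  calc (S.N * S.size * S.R : ℝ) = S.N * (S.size * S.R) := mul_assoc _ _ _
    _ ≤ S.N * (Fintype.card Proc * #(A.useful p)) := by gcongr
    _ = #(A.useful p) * S.N * Fintype.card Proc := by ring
    _ ≤ _ := by gcongr

end ParAlg

end Traffic

section Rounding

theorem cast_ceilDiv_le (a : ℕ) {b : ℕ} (hb : 0 < b) : ((a ⌈/⌉ b : ℕ) : ℝ) ≤ a / b + 1 := by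
  have hb' : (0 : ℝ) < b := Nat.cast_pos.2 hb
  rw [Nat.ceilDiv_eq_add_pred_div]
  refine Nat.cast_div_le.trans ?_
  rw [div_le_iff₀ hb', add_mul, div_mul_cancel₀ _ hb'.ne', one_mul]
  exact_mod_cast Nat.sub_le _ _

theorem cast_ceilDiv_le_mul {a b : ℕ} {c : ℝ} (hb : 0 < b) (h : (b : ℝ) ≤ (c - 1) * a) :
    ((a ⌈/⌉ b : ℕ) : ℝ) ≤ c * (a / b) := by
  have hb' : (0 : ℝ) < b := Nat.cast_pos.2 hb
  refine (cast_ceilDiv_le a hb).trans ?_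
  rw [mul_div_assoc', div_add_one hb'.ne']
  gcongr
  linarith

end Rounding

theorem Problem.cast_factorSize (S : Problem) :
    (S.factorSize : ℝ) = (∑ k, (S.I k : ℝ)) * S.R := by
  rw [factorSize, Nat.cast_sum, sum_mul]
  simp only [Nat.cast_mul]

theorem Problem.one_div_N_le_one (S : Problem) : 1 / (S.N : ℝ) ≤ 1 :=
  div_le_one_of_le₀ (Nat.one_le_cast.2 S.n.pos) (Nat.cast_nonneg _)

namespace Fits

variable {S : Problem} {G : Grid S.N} {α β γ δ : ℝ}

theorem P₀_pos (h : Fits S G α β γ δ) : 0 < G.P₀ := h.1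

theorem P_pos (h : Fits S G α β γ δ) (k : Fin S.N) : 0 < G.P k := (h.2.2.2 k).1

theorem size_pos (h : Fits S G α β γ δ) : 0 < G.size :=
  Nat.mul_pos h.P₀_pos (prod_pos fun k _ => h.P_pos k)

theorem R_pos (h : Fits S G α β γ δ) : 0 < S.R :=
  Nat.pos_of_ne_zero fun hR => by
    have := (Nat.cast_pos.2 h.P₀_pos).trans_le h.2.1
    simp [hR] at this

theorem I_pos (h : Fits S G α β γ δ) (k : Fin S.N) : 0 < S.I k :=
  Nat.pos_of_ne_zero fun hI => by
    have := (Nat.cast_pos.2 (h.P_pos k)).trans_le (h.2.2.2 k).2.1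
    simp [hI] at this

theorem problem_size_pos (h : Fits S G α β γ δ) : 0 < S.size :=
  prod_pos fun k _ => h.I_pos k

theorem γ_pos (hα : 0 ≤ α) (h : Fits S G α β γ δ) : 0 < γ := by
  have := pos_of_mul_pos_left ((Nat.cast_pos.2 h.size_pos).trans_le h.2.2.1) (Nat.cast_nonneg _)
  linarith

theorem δ_pos (h : Fits S G α β γ δ) : 0 < δ := by
  obtain ⟨-, hα, hδ⟩ := h.2.2.2 S.n
  have := pos_of_mul_pos_left ((Nat.cast_pos.2 h.P₀_pos).trans_le h.2.1) (Nat.cast_nonneg _)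
  have := pos_of_mul_pos_left ((Nat.cast_pos.2 (h.P_pos S.n)).trans_le hα) (Nat.cast_nonneg _)
  have := pos_of_mul_pos_left ((Nat.cast_pos.2 h.size_pos).trans_le hδ) (by positivity)
  nlinarith

theorem prod_ceilDiv_le (hα : 0 ≤ α) (h : Fits S G α β γ δ) :
    ((∏ k, (S.I k ⌈/⌉ G.P k) : ℕ) : ℝ) ≤ α * ∏ k, ((S.I k : ℝ) / G.P k) :=
  calc ((∏ k, (S.I k ⌈/⌉ G.P k) : ℕ) : ℝ)
      ≤ ∏ k, α ^ (1 / S.N : ℝ) * ((S.I k : ℝ) / G.P k) := by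
        rw [Nat.cast_prod]
        exact prod_le_prod (fun k _ => Nat.cast_nonneg _) fun k _ =>
          cast_ceilDiv_le_mul (h.P_pos k) (h.2.2.2 k).2.1
    _ = α * ∏ k, ((S.I k : ℝ) / G.P k) := by
        rw [prod_mul_distrib, prod_const, card_univ, Fintype.card_fin, one_div,
          Real.rpow_inv_natCast_pow hα S.n.pos.ne']

theorem tensor_block_le (hα : 0 ≤ α) (h : Fits S G α β γ δ) :
    (((∏ k, (S.I k ⌈/⌉ G.P k)) ⌈/⌉ G.P₀ : ℕ) : ℝ) ≤ γ * S.size / G.size := by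
  have hP : (0 : ℝ) < G.size := Nat.cast_pos.2 h.size_pos
  have hsize : (G.size : ℝ) = G.P₀ * ∏ k, (G.P k : ℝ) := by simp only [Grid.size]; push_cast; rfl
  calc _ ≤ ((∏ k, (S.I k ⌈/⌉ G.P k) : ℕ) : ℝ) / G.P₀ + 1 := cast_ceilDiv_le _ h.P₀_pos
    _ ≤ α * (∏ k, ((S.I k : ℝ) / G.P k)) / G.P₀ + 1 := by
        gcongr
        exact h.prod_ceilDiv_le hα
    _ = (α * S.size + G.size) / G.size := by
        rw [add_div, div_self hP.ne', prod_div_distrib, hsize, Problem.size, Nat.cast_prod,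
          mul_div_assoc', div_div, mul_comm (G.P₀ : ℝ)]
    _ ≤ γ * S.size / G.size := by
        gcongr
        linarith [h.2.2.1]

theorem matrix_block_le (h : Fits S G α β γ δ) (k : Fin S.N) :
    ((((S.I k ⌈/⌉ G.P k) * (S.R ⌈/⌉ G.P₀)) ⌈/⌉ (G.size / (G.P k * G.P₀)) : ℕ) : ℝ) ≤
      δ * (S.I k * S.R) / G.size := by
  have hP : (0 : ℝ) < G.size := Nat.cast_pos.2 h.size_pos
  have hP₀ : (0 : ℝ) < G.P₀ := Nat.cast_pos.2 h.P₀_pos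
  have hPk : (0 : ℝ) < G.P k := Nat.cast_pos.2 (h.P_pos k)
  have hdvd : G.P k * G.P₀ ∣ G.size := by
    rw [mul_comm]
    exact mul_dvd_mul_left _ (dvd_prod_of_mem _ (mem_univ k))
  have hq : 0 < G.size / (G.P k * G.P₀) :=
    Nat.div_pos (Nat.le_of_dvd h.size_pos hdvd) (Nat.mul_pos (h.P_pos k) h.P₀_pos)
  have hI := cast_ceilDiv_le_mul (h.P_pos k) (h.2.2.2 k).2.1
  have hR := cast_ceilDiv_le_mul h.P₀_pos h.2.1
  calc _ ≤ (((S.I k ⌈/⌉ G.P k) * (S.R ⌈/⌉ G.P₀) : ℕ) : ℝ) / (G.size / (G.P k * G.P₀) : ℕ) + 1 :=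
        cast_ceilDiv_le _ hq
    _ ≤ (α ^ (1 / S.N : ℝ) * (S.I k / G.P k)) * (β * (S.R / G.P₀)) /
          (G.size / (G.P k * G.P₀) : ℕ) + 1 := by
        rw [Nat.cast_mul]
        gcongr
        exact (Nat.cast_nonneg _).trans hI
    _ = (α ^ (1 / S.N : ℝ) * β * (S.I k * S.R) + G.size) / G.size := by
        rw [Nat.cast_div hdvd (by push_cast; positivity), Nat.cast_mul]
        field_simp
    _ ≤ δ * (S.I k * S.R) / G.size := by
        gcongr
        linarith [(h.2.2.2 k).2.2]

variable {D : Distribution S G}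

theorem parGen_loadBalanced (hα : 0 ≤ α) (h : Fits S G α β γ δ) (hD : D.Even) :
    D.parGen.LoadBalanced γ δ := by
  intro p
  rw [G.card_proc]
  refine ⟨(Nat.cast_le.2 (hD p).1).trans (h.tensor_block_le hα), ?_⟩
  have hcard : #(D.parGen.initA p) + #(D.parGen.finalB p) = ∑ k, #(D.locM k p) := by
    rw [Fintype.sum_eq_add_sum_subtype_ne _ S.n, add_comm]
    simp only [Distribution.parGen, card_sigma]
  calc (#(D.parGen.initA p) + #(D.parGen.finalB p) : ℝ)
      = ∑ k, (#(D.locM k p) : ℝ) := by exact_mod_cast hcard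
    _ ≤ ∑ k, δ * (S.I k * S.R) / (G.size : ℝ) := sum_le_sum fun k _ =>
        (Nat.cast_le.2 ((hD p).2 k)).trans (h.matrix_block_le k)
    _ = δ * S.factorSize / G.size := by
        rw [S.cast_factorSize, sum_mul, mul_sum, sum_div]

theorem cost_parGen_le (hα : 0 ≤ α) (h : Fits S G α β γ δ) {b : ℝ}
    (hb : ∀ k, δ * (S.I k / G.P k) ≤ b * G.P₀) (hD : D.Even) :
    (D.parGen.cost : ℝ) ≤
      (G.P₀ - 1) * (2 * (γ * S.size / G.size)) + 2 * (S.N * S.R * b) := by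
  have hP : (0 : ℝ) < G.size := Nat.cast_pos.2 h.size_pos
  have hP₀ : (0 : ℝ) < G.P₀ := Nat.cast_pos.2 h.P₀_pos
  have hcost := Nat.cast_le (α := ℝ).2
    (D.cost_parGen_le (fun p => (hD p).1) fun k p => (hD p).2 k)
  have hmatrix : ∀ k, (((G.size / (G.P k * G.P₀) - 1) * (2 * (((S.I k ⌈/⌉ G.P k) *
      (S.R ⌈/⌉ G.P₀)) ⌈/⌉ (G.size / (G.P k * G.P₀)))) : ℕ) : ℝ) ≤ 2 * (S.R * b) := fun k => by
    have hPk : (0 : ℝ) < G.P k := Nat.cast_pos.2 (h.P_pos k)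
    have hδ := h.δ_pos
    calc _ ≤ (G.size / (G.P k * G.P₀) : ℝ) * (2 * (δ * (S.I k * S.R) / G.size)) := by
          rw [Nat.cast_mul, Nat.cast_mul, Nat.cast_two]
          refine mul_le_mul ?_ (mul_le_mul_of_nonneg_left (h.matrix_block_le k) zero_le_two)
            (by positivity) (by positivity)
          exact (Nat.cast_le.2 (Nat.sub_le _ _)).trans
            (Nat.cast_div_le.trans_eq (by rw [Nat.cast_mul]))
      _ = 2 * (S.R * (δ * (S.I k / G.P k) / G.P₀)) := by field_simp
      _ ≤ 2 * (S.R * b) := by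
          gcongr
          exact (div_le_iff₀ hP₀).2 (hb k)
  calc (D.parGen.cost : ℝ) ≤ _ := hcost
    _ ≤ (G.P₀ - 1) * (2 * (γ * S.size / G.size)) + ∑ k : Fin S.N, 2 * (S.R * b) := by
        rw [Nat.cast_add, Nat.cast_sum, Nat.cast_mul, Nat.cast_mul, Nat.cast_two,
          Nat.cast_pred h.P₀_pos]
        refine add_le_add (mul_le_mul_of_nonneg_left (mul_le_mul_of_nonneg_left
          (h.tensor_block_le hα) zero_le_two) ?_) (sum_le_sum fun k _ => hmatrix k)
        exact sub_nonneg.2 (Nat.one_le_cast.2 h.P₀_pos)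
    _ = _ := by
        rw [sum_const, card_univ, Fintype.card_fin, nsmul_eq_mul]
        ring

theorem commOptimal (hα : 0 ≤ α) (h : Fits S G α β γ δ) {C lb U : ℝ}
    (hU : ∀ D : Distribution S G, D.Even → (D.parGen.cost : ℝ) ≤ U) (hlb : U ≤ C * lb)
    (hcost : ∀ A : ParAlg S (Fin G.size), A.IsMTTKRP → A.LoadBalanced γ δ → U ≤ C * A.cost) :
    CommOptimal S G γ δ C lb :=
  ⟨exists_even_distribution h.P₀_pos h.P_pos, fun D hD =>
    ⟨D.parGen_isMTTKRP, h.parGen_loadBalanced hα hD, (hU D hD).trans hlb,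
      fun A hA hbal => (hU D hD).trans (hcost A hA hbal)⟩⟩

end Fits

section Exponents

variable {n : ℝ}

theorem rpow_one_sub_mul_rpow {u : ℝ} (hu : 0 < u) (e : ℝ) : u ^ (1 - e) * u ^ e = u := by
  rw [← Real.rpow_add hu, sub_add_cancel, Real.rpow_one]

theorem inv_rpow_mul_le_of_mul_le_rpow_mul {e g u v x M : ℝ} (he : e ≤ 1) (hg : 0 < g)
    (hu : 0 < u) (hx : 0 ≤ x) (hM : 0 ≤ M) (hxg : x ≤ g * u) (h : v * u ≤ x ^ (1 - e) * M) :
    g⁻¹ ^ (1 - e) * (v * u ^ e) ≤ M := by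
  have hue : 0 < u ^ (1 - e) := by positivity
  have hvu : v * u ^ e * u ^ (1 - e) ≤ g ^ (1 - e) * M * u ^ (1 - e) :=
    calc v * u ^ e * u ^ (1 - e) = v * u := by
          rw [mul_assoc, mul_comm (u ^ e), rpow_one_sub_mul_rpow hu]
      _ ≤ (g * u) ^ (1 - e) * M := h.trans (by gcongr)
      _ = g ^ (1 - e) * M * u ^ (1 - e) := by
          rw [Real.mul_rpow hg.le hu.le, mul_right_comm]
  rw [Real.inv_rpow hg.le, inv_mul_le_iff₀ (by positivity)]
  exact le_of_mul_le_mul_right hvu hue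

theorem two_mul_le_add_of_rpow_le {K x M : ℝ} (hn : 1 ≤ n) (hK : 0 < K) (hKx : K ≤ x)
    (hM : 0 ≤ M) (h : K ^ (2 - 1 / n) ≤ x ^ (1 - 1 / n) * M) : 2 * K ≤ x + M := by
  have hx : 0 < x := hK.trans_le hKx
  have hsq : K ^ 2 ≤ x * M :=
    calc K ^ 2 = K ^ (2 - 1 / n) * K ^ (1 / n) := by
          rw [← Real.rpow_add hK, sub_add_cancel, Real.rpow_two]
      _ ≤ x ^ (1 - 1 / n) * M * x ^ (1 / n) := by gcongr
      _ = x * M := by rw [mul_right_comm, rpow_one_sub_mul_rpow hx]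
  nlinarith [sq_nonneg (x - M)]

theorem rpow_div_rpow_sub_one {u v : ℝ} (hn : 1 ≤ n) (hu : 0 < u) (hv : 0 < v) :
    (v ^ n / u ^ (n - 1)) ^ (1 / (2 * n - 1)) = (v * u) ^ (n / (2 * n - 1)) / u := by
  have hd : 2 * n - 1 ≠ 0 := by linarith
  have husplit : u ^ ((n - 1) / (2 * n - 1)) * u ^ (n / (2 * n - 1)) = u := by
    rw [← Real.rpow_add hu, ← add_div, show n - 1 + n = 2 * n - 1 by ring, div_self hd,
      Real.rpow_one]
  rw [Real.div_rpow (by positivity) (by positivity), ← Real.rpow_mul hv.le,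
    ← Real.rpow_mul hu.le, Real.mul_rpow hv.le hu.le, mul_one_div, mul_one_div,
    div_eq_div_iff (by positivity) hu.ne', mul_assoc, mul_comm (u ^ (n / _)), husplit]

theorem rpow_sub_one_div_rpow {u v : ℝ} (hn : 1 ≤ n) (hu : 0 < u) (hv : 0 < v) :
    (v ^ (n - 1) / u ^ n) ^ (1 / (2 * n - 1)) = v / (v * u) ^ (n / (2 * n - 1)) := by
  rw [← inv_div (u ^ n), Real.inv_rpow (by positivity), rpow_div_rpow_sub_one hn hv hu, inv_div,
    mul_comm]

theorem lt_rpow_of_rpow_lt {u v : ℝ} (hn : 1 ≤ n) (hu : 0 < u) (h : u ^ (1 - 1 / n) < v) :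
    u < (v * u) ^ (n / (2 * n - 1)) := by
  have hn0 : n ≠ 0 := by linarith
  have hd : 0 < 2 * n - 1 := by linarith
  have hexp : (1 - 1 / n + 1) * (n / (2 * n - 1)) = 1 := by
    rw [mul_div_assoc', div_eq_one_iff_eq hd.ne']
    field_simp
    ring
  calc u = (u ^ (1 - 1 / n) * u) ^ (n / (2 * n - 1)) := by
        rw [← Real.rpow_add_one hu.ne', ← Real.rpow_mul hu.le, hexp, Real.rpow_one]
    _ < (v * u) ^ (n / (2 * n - 1)) :=
        Real.rpow_lt_rpow (by positivity) (mul_lt_mul_of_pos_right h hu) (by positivity)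

theorem rpow_rpow_two_sub {z : ℝ} (hn : 1 ≤ n) (hz : 0 ≤ z) :
    (z ^ (n / (2 * n - 1))) ^ (2 - 1 / n) = z := by
  have hn0 : n ≠ 0 := by linarith
  have hd : 2 * n - 1 ≠ 0 := by linarith
  have hexp : n / (2 * n - 1) * (2 - 1 / n) = 1 := by
    rw [div_mul_eq_mul_div, div_eq_one_iff_eq hd]
    field_simp
  rw [← Real.rpow_mul hz, hexp, Real.rpow_one]

theorem div_le_mul_rpow_of_rpow_le {a w P : ℝ} (hn : 1 < n) (ha : 0 ≤ a) (hw : 0 < w)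
    (hP : 0 < P) (h : (a / (n * w ^ (1 / n))) ^ (n / (n - 1)) ≤ P) :
    a / P ≤ n * (w / P) ^ (1 / n) := by
  have hn0 : 0 < n := by linarith
  have hpos : 0 < 1 - 1 / n := sub_pos.2 ((div_lt_one hn0).2 hn)
  rw [← inv_div (n - 1), ← one_sub_div hn0.ne',
    Real.rpow_inv_le_iff_of_pos (by positivity) hP.le hpos, div_le_iff₀ (by positivity)] at h
  rw [Real.div_rpow hw.le hP.le, mul_div_assoc', div_le_div_iff₀ hP (by positivity)]
  calc a * P ^ (1 / n) ≤ P ^ (1 - 1 / n) * (n * w ^ (1 / n)) * P ^ (1 / n) := by gcongr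
    _ = n * w ^ (1 / n) * P := by
        rw [mul_right_comm, rpow_one_sub_mul_rpow hP, mul_comm]

theorem mul_div_le_rpow_of_rpow_le {a w R P : ℝ} (hn : 1 < n) (ha : 0 ≤ a) (hw : 0 < w)
    (hR : 0 < R) (hP : 0 < P)
    (h : a ^ ((2 * n - 1) / (n - 1)) * R / w ^ (n / (n - 1)) ≤ P) :
    a * (R / P) ≤ (w * (R / P)) ^ (n / (2 * n - 1)) := by
  have hn1 : 0 < n - 1 := by linarith
  have hd : 0 < 2 * n - 1 := by linarith
  set r := R / P with hr_def
  have hr : 0 < r := by positivity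
  have hw_exp : n / (n - 1) * ((n - 1) / (2 * n - 1)) = n / (2 * n - 1) := by field_simp
  have hr_exp : -1 * ((n - 1) / (2 * n - 1)) + 1 = n / (2 * n - 1) := by
    rw [eq_div_iff hd.ne', add_mul, mul_assoc, div_mul_cancel₀ _ hd.ne']
    ring
  rw [div_le_iff₀ (by positivity), mul_comm P, ← le_div_iff₀ hR, mul_div_assoc, ← inv_div R,
    ← hr_def, ← Real.rpow_neg_one, ← inv_div (n - 1),
    Real.rpow_inv_le_iff_of_pos ha (by positivity) (by positivity)] at h
  calc a * r ≤ (w ^ (n / (n - 1)) * r ^ (-1 : ℝ)) ^ ((n - 1) / (2 * n - 1)) * r := by gcongr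
    _ = (w * r) ^ (n / (2 * n - 1)) := by
        rw [Real.mul_rpow (by positivity) (by positivity), ← Real.rpow_mul hw.le,
          ← Real.rpow_mul hr.le, mul_assoc, ← Real.rpow_add_one hr.ne', hw_exp, hr_exp,
          Real.mul_rpow hw.le hr.le]

end Exponents

section LowerBounds

variable {S : Problem} {Proc : Type} [DecidableEq Proc] [Fintype Proc] [Nonempty Proc]

/-- The leading term `N R (I / P) ^ (1 / N)` of the communication when the tensor stays in place. -/
def stationaryTerm (S : Problem) (P : ℝ) : ℝ :=
  S.N * S.R * (S.size / P) ^ (1 / S.N : ℝ)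

/-- The leading term `(N I R / P) ^ (N / (2 N - 1))` of the communication when the tensor and the
matrices contribute equally. -/
def generalTerm (S : Problem) (P : ℝ) : ℝ :=
  (S.N * S.size * S.R / P) ^ ((S.N : ℝ) / (2 * S.N - 1))

variable {A : ParAlg S Proc} {γ δ : ℝ}

theorem ParAlg.IsMTTKRP.lbStationary_le_cost (hA : A.IsMTTKRP) (hbal : A.LoadBalanced γ δ)
    (hγ : 0 < γ) (hI : 0 < S.size) : lbStationary S (Fintype.card Proc) γ δ ≤ A.cost := by
  obtain ⟨x, M, hx₀, hM₀, hx, hM, hshare⟩ := hA.exists_access hbal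
  have hu : (0 : ℝ) < S.size / Fintype.card Proc :=
    div_pos (Nat.cast_pos.2 hI) (Nat.cast_pos.2 Fintype.card_pos)
  have hinv : 2 / (3 * γ) = (3 * γ / 2)⁻¹ := (inv_div _ _).symm
  rw [mul_div_assoc] at hx
  rw [mul_right_comm, mul_div_assoc] at hshare
  rw [lbStationary, ← div_mul_div_comm γ, hinv, mul_assoc]
  rcases le_total x (3 * γ / 2 * (S.size / Fintype.card Proc)) with hle | hle
  · have := inv_rpow_mul_le_of_mul_le_rpow_mul S.one_div_N_le_one (by positivity) hu hx₀ hM₀ hle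
      hshare
    exact (min_le_left _ _).trans (by linarith)
  · exact (min_le_right _ _).trans (by linarith)

theorem ParAlg.IsMTTKRP.mul_generalTerm_le_cost (hA : A.IsMTTKRP) (hbal : A.LoadBalanced γ δ)
    {τ : ℝ} (hγ : 1 ≤ γ) (hK : 0 < generalTerm S (Fintype.card Proc))
    (hX : (S.size : ℝ) / Fintype.card Proc ≤ generalTerm S (Fintype.card Proc))
    (hM : δ * S.factorSize / Fintype.card Proc ≤
      (2 - (γ + τ)) * generalTerm S (Fintype.card Proc)) :
    τ * generalTerm S (Fintype.card Proc) ≤ 2 * A.cost := by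
  obtain ⟨x, M, hx₀, hM₀, hx, hM', hshare⟩ := hA.exists_access hbal
  have hn : (1 : ℝ) ≤ S.N := Nat.one_le_cast.2 S.n.pos
  have hvol := rpow_rpow_two_sub hn
    (by positivity : (0 : ℝ) ≤ S.N * S.size * S.R / Fintype.card Proc)
  rw [← generalTerm] at hvol
  set K := generalTerm S (Fintype.card Proc)
  have hxK : x ≤ γ * K + A.cost := by
    rw [mul_div_assoc] at hx
    exact hx.trans (by gcongr)
  have hKx : K ≤ γ * K + A.cost := by nlinarith [(Nat.cast_nonneg A.cost : (0 : ℝ) ≤ A.cost)]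
  have hexp : 0 ≤ 1 - 1 / (S.N : ℝ) := sub_nonneg.2 S.one_div_N_le_one
  have hmean : 2 * K ≤ γ * K + A.cost + M :=
    two_mul_le_add_of_rpow_le hn hK hKx hM₀ (hvol.trans_le (hshare.trans (by gcongr)))
  linarith

end LowerBounds

section FewColumns

variable {S : Problem} {G : Grid S.N} {α β γ δ : ℝ}

theorem Fits.cost_parGen_le_stationaryTerm (hα : 0 ≤ α) (h : Fits S G α β γ δ) {ε : ℝ}
    (hP₀ : G.P₀ = 1)
    (hk : ∀ k, (S.I k / G.P k : ℝ) ≤ ε / δ * (S.size / G.size : ℝ) ^ (1 / S.N : ℝ))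
    {D : Distribution S G} (hD : D.Even) :
    (D.parGen.cost : ℝ) ≤ 2 * ε * stationaryTerm S G.size := by
  have hδ := h.δ_pos
  have hb : ∀ k, δ * (S.I k / G.P k) ≤ ε * (S.size / G.size : ℝ) ^ (1 / S.N : ℝ) * G.P₀ :=
    fun k => by
      rw [hP₀, Nat.cast_one, mul_one]
      calc δ * (S.I k / G.P k : ℝ)
          ≤ δ * (ε / δ * (S.size / G.size : ℝ) ^ (1 / S.N : ℝ)) := by gcongr; exact hk k
        _ = ε * (S.size / G.size : ℝ) ^ (1 / S.N : ℝ) := by field_simp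
  refine (h.cost_parGen_le hα hb hD).trans_eq ?_
  rw [hP₀, stationaryTerm, Nat.cast_one]
  ring

theorem min_mul_stationaryTerm_le_lbStationary {P η : ℝ} (hN : 2 ≤ S.N) (hγ : 1 ≤ γ)
    (hδ : 0 ≤ δ) (hI : 0 < S.size) (hP : 0 < P)
    (hcol : (S.N * S.R : ℝ) ≤ (S.size / P) ^ (1 - 1 / S.N : ℝ))
    (hη : η < (2 / (3 * γ)) ^ (1 - 1 / S.N : ℝ))
    (hPlarge : (δ / ((2 / (3 * γ)) ^ (1 - 1 / S.N : ℝ) - η)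
        * ((∑ k, (S.I k : ℝ)) / (S.N * (S.size : ℝ) ^ (1 / S.N : ℝ))))
      ^ ((S.N : ℝ) / (S.N - 1)) ≤ P) :
    min η (1 / 2) * stationaryTerm S P ≤ lbStationary S P γ δ := by
  have hn : (1 : ℝ) < S.N := by exact_mod_cast hN
  have hI' : (0 : ℝ) < S.size := Nat.cast_pos.2 hI
  have hu : (0 : ℝ) < S.size / P := div_pos hI' hP
  have hT : 0 ≤ stationaryTerm S P := by unfold stationaryTerm; positivity
  set c : ℝ := (2 / (3 * γ)) ^ (1 - 1 / S.N : ℝ) with hc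
  have hcη : 0 < c - η := sub_pos.2 hη
  rw [mul_div_assoc'] at hPlarge
  have hsum := div_le_mul_rpow_of_rpow_le hn (by positivity) hI' hP hPlarge
  have hfactor : δ * S.factorSize / P ≤ (c - η) * stationaryTerm S P :=
    calc δ * S.factorSize / P
        = (c - η) * S.R * (δ / (c - η) * (∑ k, (S.I k : ℝ)) / P) := by
          rw [S.cast_factorSize]
          field_simp
      _ ≤ (c - η) * S.R * (S.N * (S.size / P) ^ (1 / S.N : ℝ)) := by gcongr
      _ = (c - η) * stationaryTerm S P := by
          rw [stationaryTerm]
          ring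
  have hsize : stationaryTerm S P ≤ S.size / P :=
    (mul_le_mul_of_nonneg_right hcol (by positivity)).trans_eq (rpow_one_sub_mul_rpow hu _)
  refine le_min ?_ ?_
  · calc min η (1 / 2) * stationaryTerm S P ≤ η * stationaryTerm S P := by
          gcongr
          exact min_le_left _ _
      _ ≤ c * stationaryTerm S P - δ * S.factorSize / P := by linarith
      _ = _ := by rw [stationaryTerm, ← mul_assoc]
  · calc min η (1 / 2) * stationaryTerm S P ≤ 1 / 2 * (S.size / P) := by
          gcongr
          exact min_le_right _ _
      _ ≤ γ / 2 * (S.size / P) := by gcongr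
      _ = γ * S.size / (2 * P) := div_mul_div_comm _ _ _ _

theorem Fits.commOptimal_lbStationary {ε η : ℝ} (hε : 0 ≤ ε) (hη : 0 < η) (hN : 2 ≤ S.N)
    (hα : 1 < α) (hγ : α < γ) (h : Fits S G α β γ δ)
    (hcol : (S.N * S.R : ℝ) ≤ (S.size / G.size : ℝ) ^ (1 - 1 / S.N : ℝ)) (hP₀ : G.P₀ = 1)
    (hk : ∀ k, (S.I k / G.P k : ℝ) ≤ ε / δ * (S.size / G.size : ℝ) ^ (1 / S.N : ℝ))
    (hηc : η < (2 / (3 * γ)) ^ (1 - 1 / S.N : ℝ))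
    (hP : (δ / ((2 / (3 * γ)) ^ (1 - 1 / S.N : ℝ) - η)
        * ((∑ k, (S.I k : ℝ)) / (S.N * (S.size : ℝ) ^ (1 / S.N : ℝ))))
      ^ ((S.N : ℝ) / (S.N - 1)) ≤ G.size) :
    CommOptimal S G γ δ (2 * ε / min η (1 / 2)) (lbStationary S G.size γ δ) := by
  have hα₀ : 0 ≤ α := by linarith
  have hmin : 0 < min η (1 / 2) := lt_min hη one_half_pos
  have : NeZero G.size := ⟨h.size_pos.ne'⟩
  have hlow := min_mul_stationaryTerm_le_lbStationary hN (by linarith) h.δ_pos.le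
    h.problem_size_pos (Nat.cast_pos.2 h.size_pos) hcol hηc hP
  have hU : ∀ {y}, lbStationary S G.size γ δ ≤ y →
      2 * ε * stationaryTerm S G.size ≤ 2 * ε / min η (1 / 2) * y := fun {y} hy => by
    rw [div_mul_eq_mul_div, le_div_iff₀ hmin, mul_assoc, mul_comm _ (min η _)]
    exact mul_le_mul_of_nonneg_left (hlow.trans hy) (by positivity)
  refine h.commOptimal hα₀ (fun D hD => h.cost_parGen_le_stationaryTerm hα₀ hP₀ hk hD)
    (hU le_rfl) fun A hA hbal => hU ?_
  simpa only [Fintype.card_fin] using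
    hA.lbStationary_le_cost hbal (h.γ_pos hα₀) h.problem_size_pos

end FewColumns

section ManyColumns

variable {S : Problem} {G : Grid S.N} {α β γ δ : ℝ}

theorem Fits.cost_parGen_le_generalTerm (hα : 0 ≤ α) (h : Fits S G α β γ δ) {μ ν : ℝ}
    (hν : 0 < ν)
    (hk : ∀ k, δ / ν * ((S.N * S.R : ℝ) ^ ((S.N : ℝ) - 1) / (S.size / G.size : ℝ) ^ (S.N : ℝ))
      ^ (1 / (2 * S.N - 1) : ℝ) * (S.I k / G.P k) ≤ G.P₀)
    (hP₀ : (G.P₀ : ℝ) ≤ μ / γ * ((S.N * S.R : ℝ) ^ (S.N : ℝ)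
      / (S.size / G.size : ℝ) ^ ((S.N : ℝ) - 1)) ^ (1 / (2 * S.N - 1) : ℝ))
    {D : Distribution S G} (hD : D.Even) :
    (D.parGen.cost : ℝ) ≤ 2 * (μ + ν) * generalTerm S G.size := by
  have hn : (1 : ℝ) ≤ S.N := Nat.one_le_cast.2 S.n.pos
  have hγ := h.γ_pos hα
  have hv : (0 : ℝ) < S.N * S.R := by exact_mod_cast Nat.mul_pos S.n.pos h.R_pos
  have hu : (0 : ℝ) < S.size / G.size :=
    div_pos (Nat.cast_pos.2 h.problem_size_pos) (Nat.cast_pos.2 h.size_pos)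
  have hterm : generalTerm S G.size =
      (S.N * S.R * (S.size / G.size) : ℝ) ^ ((S.N : ℝ) / (2 * S.N - 1)) := by
    rw [generalTerm, mul_right_comm, mul_div_assoc]
  rw [rpow_div_rpow_sub_one hn hu hv, ← hterm] at hP₀
  simp only [rpow_sub_one_div_rpow hn hu hv, ← hterm] at hk
  have hK : 0 < generalTerm S G.size := by rw [hterm]; positivity
  set K := generalTerm S G.size
  set v : ℝ := S.N * S.R
  set u : ℝ := S.size / G.size with hu_def
  have hb : ∀ k, δ * (S.I k / G.P k) ≤ ν * K / v * G.P₀ := fun k =>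
    calc δ * (S.I k / G.P k : ℝ)
        = ν * K / v * (δ / ν * (v / K) * (S.I k / G.P k)) := by field_simp
      _ ≤ ν * K / v * G.P₀ := by gcongr; exact hk k
  calc (D.parGen.cost : ℝ)
      ≤ (G.P₀ - 1) * (2 * (γ * S.size / G.size)) + 2 * (v * (ν * K / v)) :=
        h.cost_parGen_le hα hb hD
    _ ≤ μ / γ * (K / u) * (2 * (γ * S.size / G.size))
          + 2 * (v * (ν * K / v)) := by
        gcongr
        linarith
    _ = 2 * (μ + ν) * K := by
        rw [mul_div_assoc γ, ← hu_def, mul_div_cancel₀ _ hv.ne']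
        field_simp

theorem factorSize_div_le_generalTerm {P c : ℝ} (hN : 2 ≤ S.N) (hI : 0 < S.size) (hR : 0 < S.R)
    (hP : 0 < P) (hδ : 0 ≤ δ) (hc : 0 < c)
    (hPlarge : (δ / c * ∑ k, (S.I k : ℝ)) ^ ((2 * S.N - 1 : ℝ) / (S.N - 1)) * S.R
      / (S.N * S.size : ℝ) ^ ((S.N : ℝ) / (S.N - 1)) ≤ P) :
    δ * S.factorSize / P ≤ c * generalTerm S P := by
  have hn : (1 : ℝ) < S.N := by exact_mod_cast hN
  have hw : (0 : ℝ) < S.N * S.size := by exact_mod_cast Nat.mul_pos S.n.pos hI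
  have hsum := mul_div_le_rpow_of_rpow_le hn (by positivity) hw (Nat.cast_pos.2 hR) hP hPlarge
  calc δ * S.factorSize / P = c * (δ / c * (∑ k, (S.I k : ℝ)) * (S.R / P)) := by
        rw [S.cast_factorSize]
        field_simp
    _ ≤ c * generalTerm S P := by
        rw [generalTerm, mul_div_assoc]
        gcongr

theorem size_div_lt_generalTerm {P : ℝ} (hI : 0 < S.size) (hP : 0 < P)
    (hcol : (S.size / P) ^ (1 - 1 / S.N : ℝ) < (S.N * S.R : ℝ)) :
    S.size / P < generalTerm S P := by
  rw [generalTerm, mul_right_comm, mul_div_assoc]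
  exact lt_rpow_of_rpow_lt (Nat.one_le_cast.2 S.n.pos) (div_pos (Nat.cast_pos.2 hI) hP) hcol

theorem Fits.commOptimal_lbGeneral {μ ν τ : ℝ} (hμ : 0 ≤ μ) (hν : 0 < ν) (hτ : 0 < τ)
    (hN : 2 ≤ S.N) (hα : 1 < α) (hγ : α < γ) (h : Fits S G α β γ δ)
    (hcol : (S.size / G.size : ℝ) ^ (1 - 1 / S.N : ℝ) < (S.N * S.R : ℝ))
    (hk : ∀ k, δ / ν * ((S.N * S.R : ℝ) ^ ((S.N : ℝ) - 1) / (S.size / G.size : ℝ) ^ (S.N : ℝ))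
      ^ (1 / (2 * S.N - 1) : ℝ) * (S.I k / G.P k) ≤ G.P₀)
    (hP₀ : (G.P₀ : ℝ) ≤ μ / γ * ((S.N * S.R : ℝ) ^ (S.N : ℝ)
      / (S.size / G.size : ℝ) ^ ((S.N : ℝ) - 1)) ^ (1 / (2 * S.N - 1) : ℝ))
    (hτγ : τ < 2 - γ)
    (hP : (δ / (2 - (γ + τ)) * ∑ k, (S.I k : ℝ)) ^ ((2 * S.N - 1 : ℝ) / (S.N - 1)) * S.R
      / (S.N * S.size : ℝ) ^ ((S.N : ℝ) / (S.N - 1)) ≤ G.size) :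
    CommOptimal S G γ δ (4 * (μ + ν) / τ) (lbGeneral S G.size γ δ) := by
  have hα₀ : 0 ≤ α := by linarith
  have hγ₁ : 1 ≤ γ := by linarith
  have hGP : (0 : ℝ) < G.size := Nat.cast_pos.2 h.size_pos
  have : NeZero G.size := ⟨h.size_pos.ne'⟩
  have hX := size_div_lt_generalTerm h.problem_size_pos hGP hcol
  have hM := factorSize_div_le_generalTerm hN h.problem_size_pos h.R_pos hGP h.δ_pos.le
    (by linarith) hP
  have hK : 0 < generalTerm S G.size := hX.trans_le' (by positivity)
  have hU : ∀ {y}, τ * generalTerm S G.size ≤ 2 * y →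
      2 * (μ + ν) * generalTerm S G.size ≤ 4 * (μ + ν) / τ * y := fun {y} hy =>
    calc 2 * (μ + ν) * generalTerm S G.size
        = 2 * (μ + ν) / τ * (τ * generalTerm S G.size) := by field_simp
      _ ≤ 2 * (μ + ν) / τ * (2 * y) := by gcongr
      _ = 4 * (μ + ν) / τ * y := by ring
  refine h.commOptimal hα₀ (fun D hD => h.cost_parGen_le_generalTerm hα₀ hν hk hP₀ hD)
    (hU ?_) fun A hA hbal => hU ?_
  · have hXγ : γ * (S.size / G.size) ≤ γ * generalTerm S G.size := by gcongr
    rw [lbGeneral, ← generalTerm, mul_div_assoc γ]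
    nlinarith
  · simpa only [Fintype.card_fin] using
      hA.mul_generalTerm_le_cost hbal hγ₁ (by simpa only [Fintype.card_fin] using hK)
        (by simpa only [Fintype.card_fin] using hX.le) (by simpa only [Fintype.card_fin] using hM)

end ManyColumns

end MTTKRP

end

theorem theorem5 :
    -- few columns: `N R ≤ (I / P) ^ (1 - 1 / N)`
    (∀ ε η : ℝ, 0 < ε → 0 < η → ∃ C : ℝ, 0 < C ∧
      ∀ (S : MTTKRP.Problem) (G : MTTKRP.Grid S.N) (α β γ δ : ℝ), 2 ≤ S.N →
        1 < α → 1 < β → α < γ → α ^ (1 / S.N : ℝ) * β < δ →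
        MTTKRP.Fits S G α β γ δ →
        (S.N * S.R : ℝ) ≤ (S.size / G.size : ℝ) ^ (1 - 1 / S.N : ℝ) →
        G.P₀ = 1 →
        (∀ k, (S.I k / G.P k : ℝ) ≤ ε / δ * (S.size / G.size : ℝ) ^ (1 / S.N : ℝ)) →
        η < (2 / (3 * γ)) ^ (1 - 1 / S.N : ℝ) →
        (δ / ((2 / (3 * γ)) ^ (1 - 1 / S.N : ℝ) - η)
            * ((∑ k, (S.I k : ℝ)) / (S.N * (S.size : ℝ) ^ (1 / S.N : ℝ))))
          ^ ((S.N : ℝ) / (S.N - 1)) ≤ G.size →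
        MTTKRP.CommOptimal S G γ δ C (MTTKRP.lbStationary S G.size γ δ)) ∧
    -- many columns: `N R > (I / P) ^ (1 - 1 / N)`
    (∀ μ ν τ : ℝ, 0 < μ → 0 < ν → 0 < τ → ∃ C : ℝ, 0 < C ∧
      ∀ (S : MTTKRP.Problem) (G : MTTKRP.Grid S.N) (α β γ δ : ℝ), 2 ≤ S.N →
        1 < α → 1 < β → α < γ → α ^ (1 / S.N : ℝ) * β < δ →
        MTTKRP.Fits S G α β γ δ →
        (S.size / G.size : ℝ) ^ (1 - 1 / S.N : ℝ) < (S.N * S.R : ℝ) →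
        (∀ k, δ / ν * ((S.N * S.R : ℝ) ^ ((S.N : ℝ) - 1) / (S.size / G.size : ℝ) ^ (S.N : ℝ))
              ^ (1 / (2 * S.N - 1) : ℝ) * (S.I k / G.P k) ≤ G.P₀) →
        (G.P₀ : ℝ) ≤ μ / γ * ((S.N * S.R : ℝ) ^ (S.N : ℝ)
              / (S.size / G.size : ℝ) ^ ((S.N : ℝ) - 1)) ^ (1 / (2 * S.N - 1) : ℝ) →
        τ < 2 - γ →
        (δ / (2 - (γ + τ)) * ∑ k, (S.I k : ℝ)) ^ ((2 * S.N - 1 : ℝ) / (S.N - 1)) * S.R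
            / (S.N * S.size : ℝ) ^ ((S.N : ℝ) / (S.N - 1)) ≤ G.size →
        MTTKRP.CommOptimal S G γ δ C (MTTKRP.lbGeneral S G.size γ δ)) := by
  refine ⟨fun ε η hε hη => ⟨2 * ε / min η (1 / 2), by positivity, ?_⟩,
    fun μ ν τ hμ hν hτ => ⟨4 * (μ + ν) / τ, by positivity, ?_⟩⟩
  · intro S G α β γ δ hN hα _ hγ _ h hcol hP₀ hk hηc hP
    exact h.commOptimal_lbStationary hε.le hη hN hα hγ hcol hP₀ hk hηc hP
  · intro S G α β γ δ hN hα _ hγ _ h hcol hk hP₀ hτγ hP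
    exact h.commOptimal_lbGeneral hμ.le hν hτ hN hα hγ hcol hk hP₀ hτγ hP
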